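/- All rings are commutative with unit. For an integer $m\ge 1$ and a ring $R$, let $\mathbb{W}_m(R)$ be the ring of $m$-truncated big Witt vectors: its underlying set is $\prod_{e\mid m}R$, and its ring structure is the one, functorial in $R$, for which all ghost coordinates $\mathrm{gh}_n:\mathbb{W}_m(R)\to R$, $(x_e)_{e\mid m}\mapsto\sum_{k\mid n}k\,x_k^{n/k}$ ($n\mid m$), are ring maps. For $e\mid f$ let $V_{f/e}:\mathbb{W}_e(R)\to\mathbb{W}_f(R)$ be the Verschiebung and $F_{f/e}:\mathbb{W}_f(R)\to\mathbb{W}_e(R)$ the Frobenius (functorial in $R$ and given in ghost coordinates by $(x_k)_{k\mid f}\mapsto (x_{(f/e)k})_{k\mid e}$). Write $\Phi_e(q)$ for the $e$-th cyclotomic polynomial and $[n]_t=1+t+\dots+t^{n-1}$. Let $q\text{-}\mathbb{W}_m(R)$ be the quotient of $\mathbb{W}_m(R)[q]$ by the ideal generated by $(q^e-1)\,\mathrm{im}(V_{m/e})$ for $e\mid m$ and by $\mathrm{im}\big([f/e]_{q^e}V_{m/f}-V_{m/e}\circ F_{f/e}\big)$ for $e\mid f\mid m$. For $d\ge 1$,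 let $q\text{-}\mathbb{W}_m^{(d)}(R)$ be the quotient of $\mathbb{W}_m(R)[q]$ by the ideal generated by $\big(\prod_{d\mid e'\mid e}\Phi_{e'}(q)\big)\,\mathrm{im}(V_{m/e})$ for $e\mid m$ and by $\mathrm{im}\big([f/e]_{q^e}V_{m/f}-V_{m/e}\circ F_{f/e}\big)$ for $d\mid e\mid f\mid m$. The $q$-ghost maps $$q\text{-}\mathbb{W}_m(R)\to\prod_{e\mid m}R[q]/\Phi_e(q),\qquad q\text{-}\mathbb{W}^{(d)}_m(R)\to\prod_{d\mid e\mid m}R[q]/\Phi_e(q)$$ are the maps of $\mathbb{Z}[q]$-algebras given by $x\mapsto(\mathrm{gh}_{m/e}(x))_e$ on $\mathbb{W}_m(R)$. Proposition (Cyclotomic Frobenii). Let $d,m\ge 1$ be integers. There exists one and only one family of ring maps $$\mathrm{Frob}_d^{\mathrm{cyc}}: q\text{-}\mathbb{W}_m(R)\longrightarrow q\text{-}\mathbb{W}_{dm}^{(d)}(R),$$ one for every commutative ring $R$, which is natural in $R$ and which is given in $q$-ghost coordinates by $(c_e(q))_{e\mid m}\mapsto(c_{e/d}(q^d))_{d\mid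 e\mid dm}$, i.e. the composition of $\mathrm{Frob}_d^{\mathrm{cyc}}$ with the $q$-ghost map of $q\text{-}\mathbb{W}_{dm}^{(d)}(R)$ is the composition of the $q$-ghost map of $q\text{-}\mathbb{W}_m(R)$ with the ring map $\prod_{e\mid m}R[q]/\Phi_e(q)\to\prod_{d\mid e\mid dm}R[q]/\Phi_e(q)$, $(c_e(q))_{e}\mapsto(c_{e/d}(q^d))_{e}$. -/

import Mathlib

open Polynomial

universe u v

noncomputable section

/-! ### Ghost components and their integral inversion -/

/-- The `n`-th ghost component `∑_{k ∣ n} k * y_k ^ (n / k)` of a family `y`. -/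
def ghostSum {R : Type u} [CommRing R] (y : ℕ → R) (n : ℕ) : R :=
  ∑ k ∈ n.divisors, (k : R) * y k ^ (n / k)

theorem map_ghostSum {R : Type u} {S : Type v} [CommRing R] [CommRing S] (f : R →+* S)
    (y : ℕ → R) (n : ℕ) : f (ghostSum y n) = ghostSum (fun k => f (y k)) n := by
  simp [ghostSum]

theorem ghostSum_congr {R : Type u} [CommRing R] {y z : ℕ → R} {n : ℕ}
    (h : ∀ k ∈ n.divisors, y k = z k) : ghostSum y n = ghostSum z n :=
  Finset.sum_congr rfl fun k hk => by rw [h k hk]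

theorem ghostSum_eq_add {R : Type u} [CommRing R] (y : ℕ → R) {n : ℕ} (hn : n ≠ 0) :
    ghostSum y n = ∑ k ∈ n.properDivisors, (k : R) * y k ^ (n / k) + (n : R) * y n := by
  rw [ghostSum, ← Nat.insert_self_properDivisors hn,
    Finset.sum_insert Nat.self_notMem_properDivisors, Nat.div_self (Nat.pos_of_ne_zero hn), pow_one,
    add_comm]

/-- The Frobenius congruences satisfied by the ghost components of a family of integral
polynomials, with respect to the Frobenius lifts that send every variable to its `p`-th power. -/
def IsDwork {σ : Type u} (G : ℕ → MvPolynomial σ ℤ) : Prop :=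
  ∀ p n : ℕ, p.Prime → n ≠ 0 → p ∣ n →
    ((p : MvPolynomial σ ℤ) ^ n.factorization p) ∣ G n - MvPolynomial.expand p (G (n / p))

theorem prime_dvd_expand_sub_pow {σ : Type u} {p : ℕ} (hp : p.Prime) (a : MvPolynomial σ ℤ) :
    (p : MvPolynomial σ ℤ) ∣ a ^ p - MvPolynomial.expand p a := by
  have := Fact.mk hp
  have : (p : MvPolynomial σ ℤ) = MvPolynomial.C (p : ℤ) := by simp
  rw [this, MvPolynomial.C_dvd_iff_zmod]
  rw [map_sub, map_pow, MvPolynomial.map_expand, MvPolynomial.expand_zmod, sub_self]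

theorem isDwork_ghostSum {σ : Type u} (y : ℕ → MvPolynomial σ ℤ) : IsDwork (ghostSum y) := by
  intro p n hp hn hpn
  obtain ⟨l, rfl⟩ := hpn
  have hl : l ≠ 0 := by rintro rfl; simp at hn
  rw [Nat.mul_div_cancel_left _ hp.pos, ghostSum, ghostSum, map_sum]
  have hsub : l.divisors ⊆ (p * l).divisors := Nat.divisors_subset_of_dvd hn (dvd_mul_left _ _)
  rw [← Finset.sum_sdiff hsub, add_sub_assoc, ← Finset.sum_sub_distrib]
  refine dvd_add (Finset.dvd_sum fun k hk => ?_) (Finset.dvd_sum fun k hk => ?_)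
  · rw [Finset.mem_sdiff, Nat.mem_divisors, Nat.mem_divisors] at hk
    obtain ⟨⟨hk1, -⟩, hk2⟩ := hk
    refine Dvd.dvd.mul_right ?_ _
    have hk0 : k ≠ 0 := by rintro rfl; exact hn (zero_dvd_iff.1 hk1)
    have : p ^ (p * l).factorization p ∣ k := by
      by_contra hcon
      apply hk2
      refine ⟨?_, hl⟩
      rw [hp.pow_dvd_iff_le_factorization hk0] at hcon
      rw [← Nat.factorization_le_iff_dvd hk0 hl]
      intro r
      have h1 := (Nat.factorization_le_iff_dvd hk0 hn).2 hk1 r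
      rw [Nat.factorization_mul hp.ne_zero hl, Finsupp.add_apply] at h1 hcon
      rw [hp.factorization] at h1 hcon
      by_cases hr : r = p
      · subst hr
        simp at h1 hcon
        omega
      · rw [Finsupp.single_eq_of_ne hr] at h1
        omega
    exact_mod_cast Nat.cast_dvd_cast (α := MvPolynomial σ ℤ) this
  · obtain ⟨j, rfl⟩ := Nat.dvd_of_mem_divisors hk
    have hk0 : k ≠ 0 := by rintro rfl; simp at hl
    have hj0 : j ≠ 0 := by rintro rfl; simp at hl
    have e1 : p * (k * j) / k = p * j := by
      rw [show p * (k * j) = k * (p * j) by ring, Nat.mul_div_cancel_left _ (by omega)]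
    have e2 : k * j / k = j := Nat.mul_div_cancel_left _ (by omega)
    rw [e1, e2, map_mul, map_natCast, ← mul_sub, map_pow]
    have e3 : (p * (k * j)).factorization p = k.factorization p + (j.factorization p + 1) := by
      rw [Nat.factorization_mul hp.ne_zero (by positivity), Nat.factorization_mul hk0 hj0]
      simp [hp.factorization]
      ring
    rw [e3, pow_add]
    refine mul_dvd_mul ?_ ?_
    · exact_mod_cast Nat.cast_dvd_cast (α := MvPolynomial σ ℤ) (Nat.ordProj_dvd k p)
    · have h := dvd_sub_pow_of_dvd_sub (prime_dvd_expand_sub_pow hp (y k)) (j.factorization p)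
      obtain ⟨t, ht⟩ := Nat.ordProj_dvd j p
      have e4 : y k ^ (p * j) = ((y k ^ p) ^ p ^ j.factorization p) ^ t := by
        rw [← pow_mul, ← pow_mul]
        congr 1
        conv_lhs => rw [ht]
      have e5 : MvPolynomial.expand p (y k) ^ j
          = (MvPolynomial.expand p (y k) ^ p ^ j.factorization p) ^ t := by
        rw [← pow_mul, ← ht]
      rw [e4, e5]
      exact h.trans (sub_dvd_pow_sub_pow _ _ _)

theorem IsDwork.add {σ : Type u} {G H : ℕ → MvPolynomial σ ℤ} (hG : IsDwork G) (hH : IsDwork H) :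
    IsDwork fun n => G n + H n := by
  intro p n hp hn hpn
  rw [map_add, add_sub_add_comm]
  exact dvd_add (hG p n hp hn hpn) (hH p n hp hn hpn)

theorem IsDwork.mul {σ : Type u} {G H : ℕ → MvPolynomial σ ℤ} (hG : IsDwork G) (hH : IsDwork H) :
    IsDwork fun n => G n * H n := by
  intro p n hp hn hpn
  rw [map_mul, show ∀ a b c e : MvPolynomial σ ℤ, a * b - c * e = (a - c) * b + c * (b - e) from
    fun a b c e => by ring]
  exact dvd_add ((hG p n hp hn hpn).mul_right _) ((hH p n hp hn hpn).mul_left _)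

theorem IsDwork.neg {σ : Type u} {G : ℕ → MvPolynomial σ ℤ} (hG : IsDwork G) :
    IsDwork fun n => -G n := by
  intro p n hp hn hpn
  rw [map_neg, neg_sub_neg, ← neg_sub]
  exact (hG p n hp hn hpn).neg_right

theorem IsDwork.shift {σ : Type u} {G : ℕ → MvPolynomial σ ℤ} (hG : IsDwork G) {c : ℕ}
    (hc : c ≠ 0) : IsDwork fun n => G (c * n) := by
  intro p n hp hn hpn
  have h := hG p (c * n) hp (mul_ne_zero hc hn) (hpn.mul_left c)
  rw [Nat.mul_div_assoc _ hpn] at h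
  refine (pow_dvd_pow _ ?_).trans h
  rw [Nat.factorization_mul hc hn]
  simp

theorem natCast_dvd_of_forall_prime {A : Type u} [CommRing A] {n : ℕ} (hn : n ≠ 0) (a : A)
    (h : ∀ p : ℕ, p.Prime → p ∣ n → ((p : A) ^ n.factorization p) ∣ a) : (n : A) ∣ a := by
  have key : ((∏ p ∈ n.primeFactors, p ^ n.factorization p : ℕ) : A) ∣ a := by
    rw [Nat.cast_prod]
    refine Finset.prod_dvd_of_coprime (fun p hp q hq hpq => ?_) fun p hp => ?_
    · have : Nat.Coprime (p ^ n.factorization p) (q ^ n.factorization q) :=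
        Nat.Coprime.pow _ _ ((Nat.coprime_primes (Nat.prime_of_mem_primeFactors hp)
          (Nat.prime_of_mem_primeFactors hq)).2 hpq)
      have h2 := (Nat.isCoprime_iff_coprime.2 this).map (Int.castRingHom A)
      simpa using h2
    · push_cast
      exact h p (Nat.prime_of_mem_primeFactors hp) (Nat.dvd_of_mem_primeFactors hp)
  rwa [show (∏ p ∈ n.primeFactors, p ^ n.factorization p) = n from
    Nat.prod_factorization_pow_eq_self hn] at key

/-- Recursive inversion of the ghost components, whenever the division by `n` is possible. -/
def ghostInv {σ : Type u} (G : ℕ → MvPolynomial σ ℤ) (n : ℕ) : MvPolynomial σ ℤ :=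
  open Classical in
  if h : ∃ r : MvPolynomial σ ℤ, G n - ∑ k : n.properDivisors,
      ((k : ℕ) : MvPolynomial σ ℤ) * ghostInv G k ^ (n / k) = (n : MvPolynomial σ ℤ) * r
  then h.choose else 0
termination_by n
decreasing_by exact (Nat.mem_properDivisors.1 k.2).2

/-- A family of integral polynomials that satisfies the Frobenius congruences is the family of
ghost components of a family of integral polynomials. -/
theorem IsDwork.ghostSum_ghostInv {σ : Type u} {G : ℕ → MvPolynomial σ ℤ} (hG : IsDwork G)
    (n : ℕ) (hn : n ≠ 0) : ghostSum (ghostInv G) n = G n := by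
  induction n using Nat.strong_induction_on with
  | _ n ih =>
    set P := ghostInv G with hP
    have hd : (n : MvPolynomial σ ℤ) ∣
        G n - ∑ k ∈ n.properDivisors, (k : MvPolynomial σ ℤ) * P k ^ (n / k) := by
      refine natCast_dvd_of_forall_prime hn _ fun p hp hpn => ?_
      have hlt : n / p < n := Nat.div_lt_self (Nat.pos_of_ne_zero hn) hp.one_lt
      have hne : n / p ≠ 0 := (Nat.div_pos (Nat.le_of_dvd (Nat.pos_of_ne_zero hn) hpn) hp.pos).ne'
      have h1 := isDwork_ghostSum (Function.update P n 0) p n hp hn hpn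
      have e1 : ghostSum (Function.update P n 0) (n / p) = G (n / p) := by
        rw [← ih _ hlt hne]
        refine ghostSum_congr fun k hk => ?_
        have := Nat.divisor_le hk
        rw [Function.update_of_ne (by omega)]
      have e2 : ghostSum (Function.update P n 0) n
          = ∑ k ∈ n.properDivisors, (k : MvPolynomial σ ℤ) * P k ^ (n / k) := by
        rw [ghostSum_eq_add _ hn, Function.update_self, mul_zero, add_zero]
        refine Finset.sum_congr rfl fun k hk => ?_
        have := (Nat.mem_properDivisors.1 hk).2
        rw [Function.update_of_ne (by omega)]
      rw [e1, e2] at h1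
      have h3 := dvd_sub (hG p n hp hn hpn) h1
      rwa [sub_sub_sub_cancel_right] at h3
    have hd' : ∃ r : MvPolynomial σ ℤ, G n - ∑ k : n.properDivisors,
        ((k : ℕ) : MvPolynomial σ ℤ) * P k ^ (n / k) = (n : MvPolynomial σ ℤ) * r := by
      rw [Finset.sum_coe_sort n.properDivisors
        (fun k => (k : MvPolynomial σ ℤ) * P k ^ (n / k))]
      exact hd
    have hPn : (n : MvPolynomial σ ℤ) * P n
        = G n - ∑ k ∈ n.properDivisors, (k : MvPolynomial σ ℤ) * P k ^ (n / k) := by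
      rw [hP, ghostInv, dif_pos hd', ← hd'.choose_spec, ← hP]
      rw [Finset.sum_coe_sort n.properDivisors
        (fun k => (k : MvPolynomial σ ℤ) * P k ^ (n / k))]
    rw [ghostSum_eq_add _ hn, hPn]
    ring

theorem ghostSum_injective {A : Type u} [CommRing A] [IsDomain A] [CharZero A] {m : ℕ}
    {y z : ℕ → A} (h : ∀ n, n ∣ m → ghostSum y n = ghostSum z n) (hm : m ≠ 0) (n : ℕ)
    (hn : n ∣ m) : y n = z n := by
  induction n using Nat.strong_induction_on with
  | _ n ih =>
    have hn0 : n ≠ 0 := ne_zero_of_dvd_ne_zero hm hn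
    have h1 := h n hn
    have h2 : ∑ k ∈ n.properDivisors, (k : A) * y k ^ (n / k)
        = ∑ k ∈ n.properDivisors, (k : A) * z k ^ (n / k) :=
      Finset.sum_congr rfl fun k hk => by
        have hk' := Nat.mem_properDivisors.1 hk
        rw [ih k hk'.2 (hk'.1.trans hn)]
    rw [ghostSum_eq_add _ hn0, ghostSum_eq_add _ hn0, h2] at h1
    exact mul_left_cancel₀ (Nat.cast_ne_zero.2 hn0) (add_left_cancel h1)

/-! ### Truncated big Witt vectors -/

/-- The `m`-truncated big Witt vectors of `R`, given by their Witt coordinates `x_e`, `e ∣ m`. -/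
@[ext]
structure BigWitt (m : ℕ) (R : Type u) : Type u where
  /-- The Witt coordinates. -/
  coeff : m.divisors → R

namespace BigWitt

variable {m : ℕ} {R : Type u} {S : Type v} [CommRing R] [CommRing S]

/-- The `n`-th Witt coordinate, extended by zero to all `n`. -/
def get (x : BigWitt m R) (n : ℕ) : R :=
  if h : n ∈ m.divisors then x.coeff ⟨n, h⟩ else 0

/-- The `n`-th ghost coordinate `∑_{k ∣ n} k * x_k ^ (n / k)`; it is meant for `n ∣ m`. -/
def ghost (x : BigWitt m R) (n : ℕ) : R := ghostSum x.get n

/-- The Witt vector whose Witt coordinates are the values of integral polynomials. -/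
def evalPoly {σ : Type*} (m : ℕ) (P : ℕ → MvPolynomial σ ℤ) (a : σ → R) : BigWitt m R :=
  ⟨fun e => MvPolynomial.aeval a (P e)⟩

/-- The universal polynomials of the sum: the integral polynomials whose ghost components are the
sums of the ghost components of two families of variables. -/
def addPoly : ℕ → MvPolynomial (ℕ ⊕ ℕ) ℤ :=
  ghostInv fun n => ghostSum (fun k => MvPolynomial.X (Sum.inl k)) n
    + ghostSum (fun k => MvPolynomial.X (Sum.inr k)) n

/-- The universal polynomials of the product. -/
def mulPoly : ℕ → MvPolynomial (ℕ ⊕ ℕ) ℤ :=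
  ghostInv fun n => ghostSum (fun k => MvPolynomial.X (Sum.inl k)) n
    * ghostSum (fun k => MvPolynomial.X (Sum.inr k)) n

/-- The universal polynomials of the additive inverse. -/
def negPoly : ℕ → MvPolynomial ℕ ℤ :=
  ghostInv fun n => -ghostSum (fun k => MvPolynomial.X k) n

/-- The universal polynomials of the `c`-th Frobenius: their `n`-th ghost component is the
`c * n`-th ghost component of the variables. -/
def frobPoly (c : ℕ) : ℕ → MvPolynomial ℕ ℤ :=
  ghostInv fun n => ghostSum (fun k => MvPolynomial.X k) (c * n)

instance : Zero (BigWitt m R) := ⟨⟨fun _ => 0⟩⟩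

instance : One (BigWitt m R) := ⟨⟨fun e => if (e : ℕ) = 1 then 1 else 0⟩⟩

instance : Add (BigWitt m R) := ⟨fun x y => evalPoly m addPoly (Sum.elim x.get y.get)⟩

instance : Mul (BigWitt m R) := ⟨fun x y => evalPoly m mulPoly (Sum.elim x.get y.get)⟩

instance : Neg (BigWitt m R) := ⟨fun x => evalPoly m negPoly x.get⟩

/-- The coordinatewise map `W_m(R) → W_m(S)` of a ring map, as a function. -/
def mapFun (f : R →+* S) (x : BigWitt m R) : BigWitt m S := ⟨fun e => f (x.coeff e)⟩

theorem get_of_dvd [NeZero m] (x : BigWitt m R) {n : ℕ} (hn : n ∣ m) :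
    x.get n = x.coeff ⟨n, Nat.mem_divisors.2 ⟨hn, NeZero.ne m⟩⟩ :=
  dif_pos _

theorem get_mapFun (f : R →+* S) (x : BigWitt m R) (n : ℕ) :
    (mapFun f x).get n = f (x.get n) := by
  unfold get mapFun
  split_ifs <;> simp

theorem ghost_mapFun (f : R →+* S) (x : BigWitt m R) (n : ℕ) :
    (mapFun f x).ghost n = f (x.ghost n) := by
  rw [ghost, ghost, map_ghostSum]
  exact ghostSum_congr fun k _ => get_mapFun f x k

theorem mapFun_evalPoly {σ : Type*} (f : R →+* S) (P : ℕ → MvPolynomial σ ℤ) (a : σ → R) :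
    mapFun f (evalPoly m P a) = evalPoly m P (fun i => f (a i)) := by
  ext e
  simp only [mapFun, evalPoly, MvPolynomial.aeval_def, MvPolynomial.hom_eval₂]
  congr 1
  exact RingHom.ext_int _ _

theorem ghost_evalPoly [NeZero m] {σ : Type*} (P : ℕ → MvPolynomial σ ℤ) (a : σ → R) {n : ℕ}
    (hn : n ∣ m) : (evalPoly m P a).ghost n = MvPolynomial.aeval a (ghostSum P n) := by
  have := map_ghostSum (MvPolynomial.aeval a : MvPolynomial σ ℤ →ₐ[ℤ] R).toRingHom P n
  simp only [AlgHom.toRingHom_eq_coe, RingHom.coe_coe] at this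
  rw [this, ghost]
  refine ghostSum_congr fun k hk => ?_
  rw [get_of_dvd _ ((Nat.dvd_of_mem_divisors hk).trans hn)]
  rfl

theorem aeval_ghostSum_X {σ : Type*} (g : ℕ → σ) (a : σ → R) (n : ℕ) :
    MvPolynomial.aeval a (ghostSum (fun k => (MvPolynomial.X (g k) : MvPolynomial σ ℤ)) n)
      = ghostSum (fun k => a (g k)) n := by
  have := map_ghostSum (MvPolynomial.aeval a : MvPolynomial σ ℤ →ₐ[ℤ] R).toRingHom
    (fun k => MvPolynomial.X (g k)) n
  simpa using this

theorem ghost_zero [NeZero m] {n : ℕ} (hn : n ∣ m) : (0 : BigWitt m R).ghost n = 0 := by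
  have hn0 : n ≠ 0 := ne_zero_of_dvd_ne_zero (NeZero.ne m) hn
  rw [ghost, ghostSum]
  refine Finset.sum_eq_zero fun k hk => ?_
  have hk' := Nat.dvd_of_mem_divisors hk
  rw [get_of_dvd _ (hk'.trans hn)]
  have : n / k ≠ 0 := by
    have := Nat.div_pos (Nat.divisor_le hk) (Nat.pos_of_mem_divisors hk)
    omega
  exact mul_eq_zero_of_right _ (zero_pow this)

theorem ghost_one [NeZero m] {n : ℕ} (hn : n ∣ m) : (1 : BigWitt m R).ghost n = 1 := by
  have hn0 : n ≠ 0 := ne_zero_of_dvd_ne_zero (NeZero.ne m) hn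
  have key : ∀ k ∈ n.divisors, (1 : BigWitt m R).get k = if k = 1 then 1 else 0 := fun k hk => by
    rw [get_of_dvd _ ((Nat.dvd_of_mem_divisors hk).trans hn)]
    rfl
  rw [ghost, ghostSum_congr key, ghostSum, Finset.sum_eq_single 1]
  · simp
  · intro k hk hk1
    have : n / k ≠ 0 := by
      have := Nat.div_pos (Nat.divisor_le hk) (Nat.pos_of_mem_divisors hk)
      omega
    simp [hk1, this]
  · intro h
    exact absurd (Nat.mem_divisors.2 ⟨one_dvd _, hn0⟩) h

theorem ghost_add [NeZero m] (x y : BigWitt m R) {n : ℕ} (hn : n ∣ m) :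
    (x + y).ghost n = x.ghost n + y.ghost n := by
  have hn0 : n ≠ 0 := ne_zero_of_dvd_ne_zero (NeZero.ne m) hn
  change (evalPoly m addPoly (Sum.elim x.get y.get)).ghost n = _
  rw [ghost_evalPoly _ _ hn, addPoly,
    ((isDwork_ghostSum _).add (isDwork_ghostSum _)).ghostSum_ghostInv n hn0, map_add,
    aeval_ghostSum_X, aeval_ghostSum_X]
  rfl

theorem ghost_mul [NeZero m] (x y : BigWitt m R) {n : ℕ} (hn : n ∣ m) :
    (x * y).ghost n = x.ghost n * y.ghost n := by
  have hn0 : n ≠ 0 := ne_zero_of_dvd_ne_zero (NeZero.ne m) hn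
  change (evalPoly m mulPoly (Sum.elim x.get y.get)).ghost n = _
  rw [ghost_evalPoly _ _ hn, mulPoly,
    ((isDwork_ghostSum _).mul (isDwork_ghostSum _)).ghostSum_ghostInv n hn0, map_mul,
    aeval_ghostSum_X, aeval_ghostSum_X]
  rfl

theorem ghost_neg [NeZero m] (x : BigWitt m R) {n : ℕ} (hn : n ∣ m) :
    (-x).ghost n = -x.ghost n := by
  have hn0 : n ≠ 0 := ne_zero_of_dvd_ne_zero (NeZero.ne m) hn
  change (evalPoly m negPoly x.get).ghost n = _
  rw [ghost_evalPoly _ _ hn, negPoly, (isDwork_ghostSum _).neg.ghostSum_ghostInv n hn0, map_neg,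
    aeval_ghostSum_X (fun k => k)]
  rfl

theorem mapFun_zero (f : R →+* S) : mapFun f (0 : BigWitt m R) = 0 := by
  ext e
  exact map_zero f

theorem mapFun_one (f : R →+* S) : mapFun f (1 : BigWitt m R) = 1 := by
  ext e
  change f (if (e : ℕ) = 1 then 1 else 0) = if (e : ℕ) = 1 then 1 else 0
  split_ifs <;> simp

theorem mapFun_add (f : R →+* S) (x y : BigWitt m R) :
    mapFun f (x + y) = mapFun f x + mapFun f y := by
  change mapFun f (evalPoly m addPoly _) = evalPoly m addPoly _
  rw [mapFun_evalPoly]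
  congr 1
  funext i
  cases i <;> simp [get_mapFun]

theorem mapFun_mul (f : R →+* S) (x y : BigWitt m R) :
    mapFun f (x * y) = mapFun f x * mapFun f y := by
  change mapFun f (evalPoly m mulPoly _) = evalPoly m mulPoly _
  rw [mapFun_evalPoly]
  congr 1
  funext i
  cases i <;> simp [get_mapFun]

theorem mapFun_neg (f : R →+* S) (x : BigWitt m R) : mapFun f (-x) = -mapFun f x := by
  change mapFun f (evalPoly m negPoly _) = evalPoly m negPoly _
  rw [mapFun_evalPoly]
  congr 1
  funext i
  simp [get_mapFun]

theorem ext_ghost {A : Type u} [CommRing A] [IsDomain A] [CharZero A] {x y : BigWitt m A}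
    (h : [NeZero m] → ∀ n, n ∣ m → x.ghost n = y.ghost n) : x = y := by
  ext e
  have he := Nat.mem_divisors.1 e.2
  have : NeZero m := ⟨he.2⟩
  have h1 := ghostSum_injective h he.2 e he.1
  rwa [get_of_dvd _ he.1, get_of_dvd _ he.1] at h1

theorem mapFun_surjective {f : R →+* S} (hf : Function.Surjective f) :
    Function.Surjective (mapFun f : BigWitt m R → BigWitt m S) := fun x =>
  ⟨⟨fun e => (hf (x.coeff e)).choose⟩, by ext e; exact (hf (x.coeff e)).choose_spec⟩

/-- The polynomial ring on the elements of `R` surjects onto `R`. -/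
def cover (R : Type u) [CommRing R] : MvPolynomial R ℤ →+* R :=
  (MvPolynomial.aeval (fun r : R => r) : MvPolynomial R ℤ →ₐ[ℤ] R).toRingHom

theorem cover_surjective (R : Type u) [CommRing R] : Function.Surjective (cover R) := fun r =>
  ⟨MvPolynomial.X r, by simp [cover]⟩

theorem mapFun_cover_surjective :
    Function.Surjective (mapFun (cover R) : BigWitt m (MvPolynomial R ℤ) → BigWitt m R) :=
  mapFun_surjective (cover_surjective R)

/-- The ring structure for which all ghost coordinates are ring maps, naturally in `R`. -/
instance instCommRing : CommRing (BigWitt m R) := by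
  refine CommRing.ofMinimalAxioms ?_ ?_ ?_ ?_ ?_ ?_ ?_
  · intro a b c
    obtain ⟨a, rfl⟩ := mapFun_cover_surjective a
    obtain ⟨b, rfl⟩ := mapFun_cover_surjective b
    obtain ⟨c, rfl⟩ := mapFun_cover_surjective c
    simp only [← mapFun_add]
    refine congrArg _ (ext_ghost fun n hn => ?_)
    simp only [ghost_add _ _ hn]
    ring
  · intro a
    obtain ⟨a, rfl⟩ := mapFun_cover_surjective a
    rw [← mapFun_zero (cover R), ← mapFun_add]
    refine congrArg _ (ext_ghost fun n hn => ?_)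
    rw [ghost_add _ _ hn, ghost_zero hn, zero_add]
  · intro a
    obtain ⟨a, rfl⟩ := mapFun_cover_surjective a
    rw [← mapFun_neg, ← mapFun_zero (cover R), ← mapFun_add]
    refine congrArg _ (ext_ghost fun n hn => ?_)
    rw [ghost_add _ _ hn, ghost_zero hn, ghost_neg _ hn, neg_add_cancel]
  · intro a b c
    obtain ⟨a, rfl⟩ := mapFun_cover_surjective a
    obtain ⟨b, rfl⟩ := mapFun_cover_surjective b
    obtain ⟨c, rfl⟩ := mapFun_cover_surjective c
    simp only [← mapFun_mul]
    refine congrArg _ (ext_ghost fun n hn => ?_)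
    simp only [ghost_mul _ _ hn]
    ring
  · intro a b
    obtain ⟨a, rfl⟩ := mapFun_cover_surjective a
    obtain ⟨b, rfl⟩ := mapFun_cover_surjective b
    simp only [← mapFun_mul]
    refine congrArg _ (ext_ghost fun n hn => ?_)
    simp only [ghost_mul _ _ hn]
    ring
  · intro a
    obtain ⟨a, rfl⟩ := mapFun_cover_surjective a
    rw [← mapFun_one (cover R), ← mapFun_mul]
    refine congrArg _ (ext_ghost fun n hn => ?_)
    rw [ghost_mul _ _ hn, ghost_one hn, one_mul]
  · intro a b c
    obtain ⟨a, rfl⟩ := mapFun_cover_surjective a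
    obtain ⟨b, rfl⟩ := mapFun_cover_surjective b
    obtain ⟨c, rfl⟩ := mapFun_cover_surjective c
    simp only [← mapFun_mul, ← mapFun_add]
    refine congrArg _ (ext_ghost fun n hn => ?_)
    simp only [ghost_mul _ _ hn, ghost_add _ _ hn]
    ring

/-- The `n`-th ghost coordinate as a ring map, for `n ∣ m`. -/
def ghostHom (R : Type u) [CommRing R] (m : ℕ) [NeZero m] (n : ℕ) (hn : n ∣ m) :
    BigWitt m R →+* R where
  toFun x := x.ghost n
  map_one' := ghost_one hn
  map_mul' x y := ghost_mul x y hn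
  map_zero' := ghost_zero hn
  map_add' x y := ghost_add x y hn

/-- The ring map `W_m(R) → W_m(S)` induced by a ring map `R → S`. -/
def map (m : ℕ) (f : R →+* S) : BigWitt m R →+* BigWitt m S where
  toFun := mapFun f
  map_one' := mapFun_one f
  map_mul' := mapFun_mul f
  map_zero' := mapFun_zero f
  map_add' := mapFun_add f

/-- The Verschiebung `V_{m/e} : W_e(R) → W_m(R)`, for `e ∣ m`. In Witt coordinates it moves the
`k`-th coordinate to place `(m / e) * k` and puts zero elsewhere. -/
def verschiebung (m : ℕ) {e : ℕ} (x : BigWitt e R) : BigWitt m R :=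
  ⟨fun k => if m / e ∣ (k : ℕ) then x.get (k / (m / e)) else 0⟩

/-- The Frobenius `F_{f/e} : W_f(R) → W_e(R)`, for `e ∣ f`, given in ghost coordinates by
`(x_k)_{k ∣ f} ↦ (x_{(f/e) k})_{k ∣ e}`, naturally in `R`. -/
def frobenius (e : ℕ) {f : ℕ} (x : BigWitt f R) : BigWitt e R :=
  evalPoly e (frobPoly (f / e)) x.get

theorem mapFun_verschiebung (f : R →+* S) {e : ℕ} (x : BigWitt e R) :
    mapFun f (verschiebung m x) = verschiebung m (mapFun f x) := by
  ext k
  simp only [mapFun, verschiebung]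
  split_ifs
  · exact (get_mapFun f x _).symm
  · exact map_zero f

theorem mapFun_frobenius (f : R →+* S) (e : ℕ) (x : BigWitt m R) :
    mapFun f (frobenius e x) = frobenius e (mapFun f x) := by
  rw [frobenius, frobenius, mapFun_evalPoly]
  congr 1
  funext k
  exact (get_mapFun f x k).symm

theorem ghost_frobenius {e f : ℕ} [NeZero e] [NeZero f] (hef : e ∣ f) (x : BigWitt f R) {n : ℕ}
    (hn : n ∣ e) : (frobenius e x).ghost n = x.ghost (f / e * n) := by
  have hn0 : n ≠ 0 := ne_zero_of_dvd_ne_zero (NeZero.ne e) hn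
  have hc : f / e ≠ 0 :=
    (Nat.div_pos (Nat.le_of_dvd (Nat.pos_of_ne_zero (NeZero.ne f)) hef)
      (Nat.pos_of_ne_zero (NeZero.ne e))).ne'
  rw [frobenius, ghost_evalPoly _ _ hn, frobPoly,
    ((isDwork_ghostSum _).shift hc).ghostSum_ghostInv n hn0, aeval_ghostSum_X (fun k => k)]
  rfl

theorem ghost_verschiebung_of_not_dvd [NeZero m] {e : ℕ} (x : BigWitt e R) {n : ℕ} (hn : n ∣ m)
    (h : ¬m / e ∣ n) : (verschiebung m x).ghost n = 0 := by
  rw [ghost, ghostSum]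
  refine Finset.sum_eq_zero fun k hk => ?_
  have hk' := Nat.dvd_of_mem_divisors hk
  have h0 : n / k ≠ 0 := by
    have := Nat.div_pos (Nat.divisor_le hk) (Nat.pos_of_mem_divisors hk)
    omega
  rw [get_of_dvd _ (hk'.trans hn)]
  have : ¬m / e ∣ k := fun h' => h (h'.trans hk')
  simp [verschiebung, this, h0]

theorem ghost_verschiebung [NeZero m] {e : ℕ} (x : BigWitt e R) {n : ℕ}
    (hn : m / e * n ∣ m) :
    (verschiebung m x).ghost (m / e * n) = ((m / e : ℕ) : R) * x.ghost n := by
  set c := m / e with hc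
  have h0 : c * n ≠ 0 := ne_zero_of_dvd_ne_zero (NeZero.ne m) hn
  have hc0 : 0 < c := Nat.pos_of_ne_zero (left_ne_zero_of_mul h0)
  rw [ghost, ghost, ghostSum, ghostSum, Finset.mul_sum]
  have hsub : n.divisors.map ⟨fun k => c * k, mul_right_injective₀ hc0.ne'⟩
      ⊆ (c * n).divisors := by
    intro k hk
    obtain ⟨j, hj, rfl⟩ := Finset.mem_map.1 hk
    exact Nat.mem_divisors.2 ⟨mul_dvd_mul_left _ (Nat.dvd_of_mem_divisors hj), h0⟩
  rw [← Finset.sum_subset hsub, Finset.sum_map]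
  · refine Finset.sum_congr rfl fun j hj => ?_
    have hj' := Nat.dvd_of_mem_divisors hj
    simp only [Function.Embedding.coeFn_mk]
    rw [get_of_dvd _ ((mul_dvd_mul_left c hj').trans hn), Nat.mul_div_mul_left _ _ hc0]
    simp only [verschiebung, ← hc, dvd_mul_right, if_true, Nat.mul_div_cancel_left _ hc0]
    push_cast
    ring
  · intro k hk hk2
    have hk' := Nat.dvd_of_mem_divisors hk
    have hck : ¬c ∣ k := by
      rintro ⟨j, rfl⟩
      refine hk2 (Finset.mem_map.2 ⟨j, Nat.mem_divisors.2
        ⟨Nat.dvd_of_mul_dvd_mul_left hc0 hk', right_ne_zero_of_mul h0⟩, rfl⟩)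
    have hne : c * n / k ≠ 0 := by
      have := Nat.div_pos (Nat.divisor_le hk) (Nat.pos_of_mem_divisors hk)
      omega
    rw [get_of_dvd _ (hk'.trans hn)]
    simp [verschiebung, ← hc, hck, hne]

end BigWitt

/-! ### Cyclotomic quotients -/

/-- The ring `R[q] / Φ_e(q)`. -/
abbrev CycQuot (R : Type u) [CommRing R] (e : ℕ) : Type u :=
  R[X] ⧸ Ideal.span {cyclotomic e R}

theorem cyclotomic_dvd_expand (R : Type u) [CommRing R] {d e : ℕ} (h : d ∣ e) :
    cyclotomic e R ∣ expand R d (cyclotomic (e / d) R) := by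
  rcases Nat.eq_zero_or_pos e with rfl | he
  · simp
  have hd : 0 < d := Nat.pos_of_dvd_of_pos h he
  have key : cyclotomic e ℤ ∣ expand ℤ d (cyclotomic (e / d) ℤ) := by
    have hz := Complex.isPrimitiveRoot_exp e he.ne'
    rw [cyclotomic_eq_minpoly hz he]
    refine minpoly.isIntegrallyClosed_dvd (hz.isIntegral he) ?_
    rw [expand_aeval]
    have hz' : IsPrimitiveRoot (Complex.exp (2 * Real.pi * Complex.I / e) ^ d) (e / d) :=
      hz.pow he (Nat.mul_div_cancel' h).symm
    have := hz'.isRoot_cyclotomic (Nat.div_pos (Nat.le_of_dvd he h) hd)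
    rwa [IsRoot.def, ← map_cyclotomic_int, eval_map] at this
  have := Polynomial.map_dvd (Int.castRingHom R) key
  rwa [map_expand, map_cyclotomic_int, map_cyclotomic_int] at this

/-- The ring map `R[q] / Φ_{e/d}(q) → R[q] / Φ_e(q)`, `c(q) ↦ c(q^d)`, for `d ∣ e`. -/
def cycSubst (R : Type u) [CommRing R] {d e : ℕ} (h : d ∣ e) :
    CycQuot R (e / d) →+* CycQuot R e :=
  Ideal.quotientMap _ (expand R d : R[X] →+* R[X]) (by
    rw [Ideal.span_singleton_le_iff_mem, Ideal.mem_comap, Ideal.mem_span_singleton]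
    exact cyclotomic_dvd_expand R h)

/-- The `q`-integer `[n]_t = 1 + t + ⋯ + t^(n-1)`. -/
def qInt {A : Type u} [CommRing A] (n : ℕ) (t : A) : A := ∑ i ∈ Finset.range n, t ^ i

/-! ### Big `q`-Witt vectors -/

open BigWitt in
/-- The ideal of `W_m(R)[q]` that defines the big `q`-Witt vectors. -/
def qWittIdeal (m : ℕ) (R : Type u) [CommRing R] : Ideal (BigWitt m R)[X] :=
  Ideal.span
    ({a | ∃ e : ℕ, e ∣ m ∧ ∃ x : BigWitt e R, a = (X ^ e - 1) * C (verschiebung m x)} ∪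
     {a | ∃ d e : ℕ, d ∣ e ∧ e ∣ m ∧ ∃ x : BigWitt e R,
        a = qInt (e / d) (X ^ d) * C (verschiebung m x)
          - C (verschiebung m (frobenius d x))})

/-- The `m`-truncated big `q`-Witt vectors `q-W_m(R)`. -/
abbrev QWitt (m : ℕ) (R : Type u) [CommRing R] : Type u := (BigWitt m R)[X] ⧸ qWittIdeal m R

open BigWitt in
/-- The ideal of `W_m(R)[q]` that defines the big `q`-Witt vectors at `d`. -/
def qWittAtIdeal (d m : ℕ) (R : Type u) [CommRing R] : Ideal (BigWitt m R)[X] :=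
  Ideal.span
    ({a | ∃ e : ℕ, e ∣ m ∧ ∃ x : BigWitt e R,
        a = (∏ k ∈ e.divisors with d ∣ k, cyclotomic k (BigWitt m R)) * C (verschiebung m x)} ∪
     {a | ∃ e f : ℕ, d ∣ e ∧ e ∣ f ∧ f ∣ m ∧ ∃ x : BigWitt f R,
        a = qInt (f / e) (X ^ e) * C (verschiebung m x)
          - C (verschiebung m (frobenius e x))})

/-- The `m`-truncated big `q`-Witt vectors at `d`, `q-W_m^{(d)}(R)`. -/
abbrev QWittAt (d m : ℕ) (R : Type u) [CommRing R] : Type u :=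
  (BigWitt m R)[X] ⧸ qWittAtIdeal d m R

theorem map_qInt {A : Type u} {B : Type v} [CommRing A] [CommRing B] (f : A →+* B) (n : ℕ)
    (t : A) : f (qInt n t) = qInt n (f t) := by
  simp [qInt]

theorem qWittIdeal_le_comap {R : Type u} {S : Type v} [CommRing R] [CommRing S] (m : ℕ)
    (f : R →+* S) :
    qWittIdeal m R ≤ (qWittIdeal m S).comap (mapRingHom (BigWitt.map m f)) := by
  rw [qWittIdeal, Ideal.span_le]
  rintro a (⟨e, he, x, rfl⟩ | ⟨d, e, hde, he, x, rfl⟩)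
  · refine Ideal.subset_span (Or.inl ⟨e, he, BigWitt.mapFun f x, ?_⟩)
    rw [← BigWitt.mapFun_verschiebung]
    simp [BigWitt.map]
  · refine Ideal.subset_span (Or.inr ⟨d, e, hde, he, BigWitt.mapFun f x, ?_⟩)
    rw [← BigWitt.mapFun_verschiebung, ← BigWitt.mapFun_frobenius, ← BigWitt.mapFun_verschiebung]
    rw [map_sub, map_mul, map_qInt]
    simp [BigWitt.map]

theorem qWittAtIdeal_le_comap {R : Type u} {S : Type v} [CommRing R] [CommRing S] (d m : ℕ)
    (f : R →+* S) :
    qWittAtIdeal d m R ≤ (qWittAtIdeal d m S).comap (mapRingHom (BigWitt.map m f)) := by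
  rw [qWittAtIdeal, Ideal.span_le]
  rintro a (⟨e, he, x, rfl⟩ | ⟨e, g, hde, heg, hg, x, rfl⟩)
  · refine Ideal.subset_span (Or.inl ⟨e, he, BigWitt.mapFun f x, ?_⟩)
    rw [← BigWitt.mapFun_verschiebung]
    simp [BigWitt.map, Polynomial.map_prod, map_cyclotomic]
  · refine Ideal.subset_span (Or.inr ⟨e, g, hde, heg, hg, BigWitt.mapFun f x, ?_⟩)
    rw [← BigWitt.mapFun_verschiebung, ← BigWitt.mapFun_frobenius, ← BigWitt.mapFun_verschiebung]
    rw [map_sub, map_mul, map_qInt]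
    simp [BigWitt.map]

/-- The ring map `q-W_m(R) → q-W_m(S)` induced by a ring map `R → S`. -/
def QWitt.map {R : Type u} {S : Type v} [CommRing R] [CommRing S] (m : ℕ) (f : R →+* S) :
    QWitt m R →+* QWitt m S :=
  Ideal.quotientMap _ (mapRingHom (BigWitt.map m f)) (qWittIdeal_le_comap m f)

/-- The ring map `q-W_m^{(d)}(R) → q-W_m^{(d)}(S)` induced by a ring map `R → S`. -/
def QWittAt.map {R : Type u} {S : Type v} [CommRing R] [CommRing S] (d m : ℕ) (f : R →+* S) :
    QWittAt d m R →+* QWittAt d m S :=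
  Ideal.quotientMap _ (mapRingHom (BigWitt.map m f)) (qWittAtIdeal_le_comap d m f)

/-! ### `q`-ghost maps -/

/-- The ring map `W_m(R)[q] → R[q] / Φ_e(q)` with `q ↦ q` and `x ↦ gh_{m/e}(x)` for
`x ∈ W_m(R)`, where `e ∣ m`. -/
def preQGhost (R : Type u) [CommRing R] (m : ℕ) [NeZero m] (e : ℕ) (he : e ∣ m) :
    (BigWitt m R)[X] →+* CycQuot R e :=
  (Ideal.Quotient.mk _).comp (mapRingHom (BigWitt.ghostHom R m (m / e) (Nat.div_dvd_of_dvd he)))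

theorem cyclotomic_dvd_qInt (R : Type u) [CommRing R] {k e f : ℕ} (hef : e ∣ f) (hf : f ≠ 0)
    (hkf : k ∣ f) (hke : ¬k ∣ e) : cyclotomic k R ∣ qInt (f / e) (X ^ e : R[X]) := by
  have key : cyclotomic k ℤ ∣ qInt (f / e) (X ^ e : ℤ[X]) := by
    have hk0 : 0 < k := Nat.pos_of_dvd_of_pos hkf (Nat.pos_of_ne_zero hf)
    have h1 : qInt (f / e) (X ^ e : ℤ[X]) * (X ^ e - 1) = X ^ f - 1 := by
      rw [qInt, geom_sum_mul, ← pow_mul, Nat.mul_div_cancel' hef]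
    have h2 : cyclotomic k ℤ ∣ qInt (f / e) (X ^ e : ℤ[X]) * (X ^ e - 1) :=
      h1 ▸ (cyclotomic.dvd_X_pow_sub_one k ℤ).trans (by
        obtain ⟨j, rfl⟩ := hkf
        simpa [pow_mul] using sub_one_dvd_pow_sub_one (X ^ k : ℤ[X]) j)
    refine ((cyclotomic.irreducible hk0).prime.dvd_or_dvd h2).resolve_right fun h3 => hke ?_
    have hz := Complex.isPrimitiveRoot_exp k hk0.ne'
    have hr := hz.isRoot_cyclotomic hk0
    rw [IsRoot.def, ← map_cyclotomic_int, eval_map] at hr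
    obtain ⟨g, hg⟩ := h3
    have h4 := congrArg (eval₂ (Int.castRingHom ℂ)
      (Complex.exp (2 * Real.pi * Complex.I / k))) hg
    rw [eval₂_mul, hr, zero_mul] at h4
    simp only [eval₂_sub, eval₂_pow, eval₂_X, eval₂_one, sub_eq_zero] at h4
    exact hz.dvd_of_pow_eq_one _ h4
  have := Polynomial.map_dvd (Int.castRingHom R) key
  rw [map_cyclotomic_int, ← coe_mapRingHom, map_qInt] at this
  simpa using this

theorem dvd_of_div_dvd_div {m e k : ℕ} (hm : m ≠ 0) (he : e ∣ m) (hk : k ∣ m)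
    (h : m / e ∣ m / k) : k ∣ e := by
  obtain ⟨a, rfl⟩ := he
  have he0 : 0 < e := Nat.pos_of_ne_zero (left_ne_zero_of_mul hm)
  have ha0 : 0 < a := Nat.pos_of_ne_zero (right_ne_zero_of_mul hm)
  rw [Nat.mul_div_cancel_left _ he0] at h
  obtain ⟨c, hc⟩ := h
  refine ⟨c, Nat.eq_of_mul_eq_mul_right ha0 ?_⟩
  rw [mul_assoc, mul_comm c a, ← hc, Nat.mul_div_cancel' hk]

theorem div_mul_div_self {m e k : ℕ} (he : e ∣ m) (hk : k ∣ e) : m / e * (e / k) = m / k := by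
  obtain ⟨b, rfl⟩ := hk
  obtain ⟨a, rfl⟩ := he
  rcases Nat.eq_zero_or_pos k with rfl | hk0
  · simp
  rcases Nat.eq_zero_or_pos b with rfl | hb0
  · simp
  rw [Nat.mul_div_cancel_left _ (by positivity), Nat.mul_div_cancel_left _ hk0, mul_assoc,
    Nat.mul_div_cancel_left _ hk0, mul_comm]

theorem preQGhost_C (R : Type u) [CommRing R] (m : ℕ) [NeZero m] (k : ℕ) (hk : k ∣ m)
    (x : BigWitt m R) : preQGhost R m k hk (C x) = Ideal.Quotient.mk _ (C (x.ghost (m / k))) := by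
  simp [preQGhost, BigWitt.ghostHom]

theorem preQGhost_verschiebung_of_not_dvd (R : Type u) [CommRing R] (m : ℕ) [NeZero m] {k e : ℕ}
    (hk : k ∣ m) (he : e ∣ m) (x : BigWitt e R) (hke : ¬k ∣ e) :
    preQGhost R m k hk (C (BigWitt.verschiebung m x)) = 0 := by
  rw [preQGhost_C, BigWitt.ghost_verschiebung_of_not_dvd _ (Nat.div_dvd_of_dvd hk), C_0, map_zero]
  exact fun h => hke (dvd_of_div_dvd_div (NeZero.ne m) he hk h)

theorem preQGhost_verschiebung (R : Type u) [CommRing R] (m : ℕ) [NeZero m] {k e : ℕ}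
    (hk : k ∣ m) (he : e ∣ m) (x : BigWitt e R) (hke : k ∣ e) :
    preQGhost R m k hk (C (BigWitt.verschiebung m x))
      = ((m / e : ℕ) : CycQuot R k) * Ideal.Quotient.mk _ (C (x.ghost (e / k))) := by
  rw [preQGhost_C, ← div_mul_div_self he hke, BigWitt.ghost_verschiebung]
  · simp
  · rw [div_mul_div_self he hke]
    exact Nat.div_dvd_of_dvd hk

theorem preQGhost_eq_zero (R : Type u) [CommRing R] {d m : ℕ} [NeZero m] {k : ℕ} (hdk : d ∣ k)
    (hk : k ∣ m) (a : (BigWitt m R)[X]) (ha : a ∈ qWittAtIdeal d m R) :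
    preQGhost R m k hk a = 0 := by
  have hm : m ≠ 0 := NeZero.ne m
  rw [← RingHom.mem_ker]
  revert a
  change qWittAtIdeal d m R ≤ RingHom.ker (preQGhost R m k hk)
  rw [qWittAtIdeal, Ideal.span_le]
  rintro a (⟨e, he, x, rfl⟩ | ⟨e, f, hde, hef, hf, x, rfl⟩)
  · rw [SetLike.mem_coe, RingHom.mem_ker, map_mul]
    by_cases hke : k ∣ e
    · refine mul_eq_zero_of_left ?_ _
      rw [preQGhost, RingHom.comp_apply, coe_mapRingHom, Polynomial.map_prod,
        Ideal.Quotient.eq_zero_iff_mem, Ideal.mem_span_singleton]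
      refine dvd_trans (dvd_of_eq ?_) (Finset.dvd_prod_of_mem _ (a := k) ?_)
      · rw [map_cyclotomic]
      · exact Finset.mem_filter.2
          ⟨Nat.mem_divisors.2 ⟨hke, ne_zero_of_dvd_ne_zero hm he⟩, hdk⟩
    · rw [preQGhost_verschiebung_of_not_dvd R m hk he x hke, mul_zero]
  · have hf0 : f ≠ 0 := ne_zero_of_dvd_ne_zero hm hf
    have he0 : e ≠ 0 := ne_zero_of_dvd_ne_zero hf0 hef
    have : NeZero f := ⟨hf0⟩
    have : NeZero e := ⟨he0⟩
    have hX : preQGhost R m k hk X = Ideal.Quotient.mk _ X := by simp [preQGhost]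
    rw [SetLike.mem_coe, RingHom.mem_ker, map_sub, map_mul, map_qInt, map_pow, hX]
    by_cases hkf : k ∣ f
    · by_cases hke : k ∣ e
      · rw [preQGhost_verschiebung R m hk hf x hkf,
          preQGhost_verschiebung R m hk (hef.trans hf) _ hke,
          BigWitt.ghost_frobenius hef x (Nat.div_dvd_of_dvd hke), div_mul_div_self hef hke]
        have hq : (Ideal.Quotient.mk (Ideal.span {cyclotomic k R}) X) ^ e = 1 := by
          rw [← map_pow, ← map_one (Ideal.Quotient.mk (Ideal.span {cyclotomic k R})),
            Ideal.Quotient.eq, Ideal.mem_span_singleton]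
          refine (cyclotomic.dvd_X_pow_sub_one k R).trans ?_
          obtain ⟨j, rfl⟩ := hke
          simpa [pow_mul] using sub_one_dvd_pow_sub_one (X ^ k : R[X]) j
        have hn : (m / f) * (f / e) = m / e := div_mul_div_self hf hef
        rw [hq, ← hn]
        simp only [qInt, one_pow, Finset.sum_const, Finset.card_range, nsmul_eq_mul, mul_one]
        push_cast
        ring
      · have hq : qInt (f / e) ((Ideal.Quotient.mk (Ideal.span {cyclotomic k R}) X) ^ e) = 0 := by
          rw [← map_pow, ← map_qInt, Ideal.Quotient.eq_zero_iff_mem, Ideal.mem_span_singleton]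
          exact cyclotomic_dvd_qInt R hef hf0 hkf hke
        rw [hq, preQGhost_verschiebung_of_not_dvd R m hk (hef.trans hf) _ hke, zero_mul, sub_zero]
    · rw [preQGhost_verschiebung_of_not_dvd R m hk hf x hkf,
        preQGhost_verschiebung_of_not_dvd R m hk (hef.trans hf) _ fun h => hkf (h.trans hef),
        mul_zero, sub_zero]

theorem qWittIdeal_le (R : Type u) [CommRing R] (m : ℕ) [NeZero m] :
    qWittIdeal m R ≤ qWittAtIdeal 1 m R := by
  rw [qWittIdeal, Ideal.span_le]
  rintro a (⟨e, he, x, rfl⟩ | ⟨d, e, hde, he, x, rfl⟩)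
  · refine Ideal.subset_span (Or.inl ⟨e, he, x, ?_⟩)
    have he0 : 0 < e := Nat.pos_of_ne_zero (ne_zero_of_dvd_ne_zero (NeZero.ne m) he)
    simp [prod_cyclotomic_eq_X_pow_sub_one he0]
  · exact Ideal.subset_span (Or.inr ⟨d, e, one_dvd _, hde, he, x, rfl⟩)

/-- The `q`-ghost map `q-W_m(R) → ∏_{e ∣ m} R[q] / Φ_e(q)`: the map of `ℤ[q]`-algebras given by
`x ↦ (gh_{m/e}(x))_e` on `W_m(R)`. -/
def qGhost (R : Type u) [CommRing R] (m : ℕ) [NeZero m] :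
    QWitt m R →+* ((e : {e : ℕ // e ∣ m}) → CycQuot R e) :=
  RingHom.pi fun e => Ideal.Quotient.lift _ (preQGhost R m e e.2) fun a ha =>
    preQGhost_eq_zero R (one_dvd _) e.2 a (qWittIdeal_le R m ha)

/-- The `q`-ghost map `q-W_m^{(d)}(R) → ∏_{d ∣ e ∣ m} R[q] / Φ_e(q)`: the map of `ℤ[q]`-algebras
given by `x ↦ (gh_{m/e}(x))_e` on `W_m(R)`. -/
def qGhostAt (R : Type u) [CommRing R] (d m : ℕ) [NeZero m] :
    QWittAt d m R →+* ((e : {e : ℕ // d ∣ e ∧ e ∣ m}) → CycQuot R e) :=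
  RingHom.pi fun e => Ideal.Quotient.lift _ (preQGhost R m e e.2.2) fun a ha =>
    preQGhost_eq_zero R e.2.1 e.2.2 a ha

/-- The ring map `(c_e(q))_{e ∣ m} ↦ (c_{e/d}(q^d))_{d ∣ e ∣ dm}`. -/
def ghostFrob (R : Type u) [CommRing R] (d m : ℕ) [NeZero d] :
    ((e : {e : ℕ // e ∣ m}) → CycQuot R e) →+*
      ((e : {e : ℕ // d ∣ e ∧ e ∣ d * m}) → CycQuot R e) :=
  RingHom.pi fun e => (cycSubst R e.2.1).comp
    (Pi.evalRingHom (fun e : {e : ℕ // e ∣ m} => CycQuot R e)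
      ⟨(e : ℕ) / d, (Nat.div_dvd_iff_dvd_mul e.2.1 (NeZero.pos d)).2 e.2.2⟩)

end

/-! Existence. If `d` does not divide `e ∣ dm`, the product of the `Φ_k` over `d ∣ k ∣ e` is empty,
so the image of `V_{dm/e}` dies in `q-W_{dm}^{(d)}(R)`. These images generate the kernel of the
truncation `W_{dm}(R) → W_m(R)`, so `W_{dm}(R) → q-W_{dm}^{(d)}(R)` factors through `W_m(R)`
(`C_mem_of_truncFun_eq_zero`). Extending by `q ↦ q^d` carries the relations at `e ∣ f` to
consequences of those at `de ∣ df` (`preCycFrob_eq_zero`).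

Uniqueness. Every `R` is a quotient of a polynomial ring `ℤ[T]`, and `R ↦ q-W_m(R)` preserves
surjections, so by naturality `R = ℤ[T]` suffices. There the `q`-ghost map of the target is
injective (`qGhostAt_injective`).

Injectivity. `W_{dm}(ℤ[T])` is additively generated by Verschiebungen of Teichmüller representatives
of monomials. For a monomial `T^s` let `g` be the largest divisor of `m` such that `T^s` is a `g`-th
power, and let `v_s` be the class of `V_{m/g}[T^{s/g}]`, coming from level `dg`. The relations make
the `v_s` generate the target over `ℤ[q]`, and `∏_{d ∣ k ∣ dg} Φ_k` annihilates `v_s`. The ghost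
coordinate of `v_s` at `de` is `(m/g) T^{s/e}` if `e ∣ g`, and zero otherwise. For fixed `e` these
monomials are distinct, so if `∑ c_s v_s` has zero ghost coordinates, then `Φ_{de} ∣ c_s` for all `e
∣ g`; hence the product divides `c_s` and `c_s v_s = 0`. -/

namespace BigWitt

/-! ### Truncation and Teichmüller representatives -/

section Truncation

variable {R : Type u} {S : Type v} [CommRing R] [CommRing S]

/-- The truncation `W_N(R) → W_m(R)`, for `m ∣ N`, as a function. -/
def truncFun (m : ℕ) {N : ℕ} (x : BigWitt N R) : BigWitt m R := ⟨fun k => x.get k⟩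

theorem get_truncFun {m N : ℕ} [NeZero m] (x : BigWitt N R) {n : ℕ} (hn : n ∣ m) :
    (truncFun m x).get n = x.get n := by
  rw [get_of_dvd _ hn, truncFun]

theorem ghost_truncFun {m N : ℕ} [NeZero m] (x : BigWitt N R) {n : ℕ} (hn : n ∣ m) :
    (truncFun m x).ghost n = x.ghost n :=
  ghostSum_congr fun _ hk => get_truncFun x ((Nat.dvd_of_mem_divisors hk).trans hn)

theorem mapFun_truncFun (f : R →+* S) {m N : ℕ} (x : BigWitt N R) :
    mapFun f (truncFun m x) = truncFun m (mapFun f x) := by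
  ext k
  exact (get_mapFun f x k).symm

theorem truncFun_surjective {m N : ℕ} [NeZero m] [NeZero N] (h : m ∣ N) :
    Function.Surjective (truncFun m : BigWitt N R → BigWitt m R) := fun x => by
  -- `truncFun` is used in the opposite direction: `get` is zero off the divisors of `m`, so this is
  -- extension by zero.
  refine ⟨truncFun N x, ?_⟩
  ext k
  have hk := Nat.dvd_of_mem_divisors k.2
  change (truncFun N x).get k = _
  rw [get_truncFun x (hk.trans h), get_of_dvd x hk]

/-- The truncation `W_N(R) → W_m(R)`, for `m ∣ N`. -/
def trunc (R : Type u) [CommRing R] {m N : ℕ} [NeZero m] [NeZero N] (h : m ∣ N) :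
    BigWitt N R →+* BigWitt m R where
  toFun := truncFun m
  map_one' := by
    -- Each identity is lifted along `cover R` to a polynomial ring over `ℤ`, where ghost
    -- coordinates determine a Witt vector.
    rw [← mapFun_one (cover R), ← mapFun_truncFun, ← mapFun_one (cover R)]
    refine congrArg _ (ext_ghost fun n hn => ?_)
    rw [ghost_truncFun _ hn, ghost_one hn, ghost_one (hn.trans h)]
  map_zero' := by
    rw [← mapFun_zero (cover R), ← mapFun_truncFun, ← mapFun_zero (cover R)]
    refine congrArg _ (ext_ghost fun n hn => ?_)
    rw [ghost_truncFun _ hn, ghost_zero hn, ghost_zero (hn.trans h)]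
  map_add' x y := by
    obtain ⟨x, rfl⟩ := mapFun_cover_surjective x
    obtain ⟨y, rfl⟩ := mapFun_cover_surjective y
    simp only [← mapFun_add, ← mapFun_truncFun]
    refine congrArg _ (ext_ghost fun n hn => ?_)
    rw [ghost_truncFun _ hn, ghost_add _ _ hn, ghost_add _ _ (hn.trans h), ghost_truncFun _ hn,
      ghost_truncFun _ hn]
  map_mul' x y := by
    obtain ⟨x, rfl⟩ := mapFun_cover_surjective x
    obtain ⟨y, rfl⟩ := mapFun_cover_surjective y
    simp only [← mapFun_mul, ← mapFun_truncFun]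
    refine congrArg _ (ext_ghost fun n hn => ?_)
    rw [ghost_truncFun _ hn, ghost_mul _ _ hn, ghost_mul _ _ (hn.trans h), ghost_truncFun _ hn,
      ghost_truncFun _ hn]

/-- Both Verschiebungen move coordinates by the same factor `dm/(de) = m/e`. With
`truncFun_frobenius`, this matches the relations at level `m` with those at level `dm` whose indices
are multiplied by `d`. -/
theorem truncFun_verschiebung {d m e : ℕ} [NeZero d] [NeZero m] (he : e ∣ m)
    (x : BigWitt (d * e) R) :
    truncFun m (verschiebung (d * m) x) = verschiebung m (truncFun e x) := by
  have : NeZero e := ⟨ne_zero_of_dvd_ne_zero (NeZero.ne m) he⟩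
  ext ⟨k, hk⟩
  have hkm := Nat.dvd_of_mem_divisors hk
  change (verschiebung (d * m) x).get k = _
  rw [get_of_dvd _ (hkm.mul_left d)]
  simp only [verschiebung, Nat.mul_div_mul_left _ _ (NeZero.pos d)]
  split_ifs with h
  · rw [get_truncFun]
    obtain ⟨a, rfl⟩ := he
    rw [Nat.mul_div_cancel_left _ (NeZero.pos e)] at h ⊢
    obtain ⟨b, rfl⟩ := h
    have ha : 0 < a := Nat.pos_of_ne_zero (right_ne_zero_of_mul (NeZero.ne (e * a)))
    rw [Nat.mul_div_cancel_left _ ha]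
    rw [mul_comm e] at hkm
    exact Nat.dvd_of_mul_dvd_mul_left ha hkm
  · rfl

theorem truncFun_frobenius {d e f : ℕ} [NeZero d] [NeZero e] [NeZero f] (hef : e ∣ f)
    (x : BigWitt (d * f) R) :
    truncFun e (frobenius (d * e) x) = frobenius e (truncFun f x) := by
  obtain ⟨x, rfl⟩ := mapFun_cover_surjective x
  simp only [← mapFun_frobenius, ← mapFun_truncFun]
  refine congrArg _ (ext_ghost fun n hn => ?_)
  rw [ghost_truncFun _ hn, ghost_frobenius (mul_dvd_mul_left d hef) _ (hn.mul_left d),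
    ghost_frobenius hef _ hn, ghost_truncFun, Nat.mul_div_mul_left _ _ (NeZero.pos d)]
  calc f / e * n ∣ f / e * e := mul_dvd_mul_left _ hn
    _ = f := Nat.div_mul_cancel hef

/-- The Teichmüller representative `[a]` in `W_m(R)`. -/
def teichmuller (m : ℕ) (a : R) : BigWitt m R := ⟨fun k => if (k : ℕ) = 1 then a else 0⟩

theorem ghost_teichmuller {m : ℕ} [NeZero m] (a : R) {n : ℕ} (hn : n ∣ m) :
    (teichmuller m a).ghost n = a ^ n := by
  have hn0 : n ≠ 0 := ne_zero_of_dvd_ne_zero (NeZero.ne m) hn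
  have key : ∀ k ∈ n.divisors, (teichmuller m a).get k = if k = 1 then a else 0 := fun k hk => by
    rw [get_of_dvd _ ((Nat.dvd_of_mem_divisors hk).trans hn)]
    rfl
  rw [ghost, ghostSum_congr key, ghostSum, Finset.sum_eq_single 1]
  · simp
  · intro k hk hk1
    have : n / k ≠ 0 := by
      have := Nat.div_pos (Nat.divisor_le hk) (Nat.pos_of_mem_divisors hk)
      omega
    simp [hk1, this]
  · intro h
    exact absurd (Nat.mem_divisors.2 ⟨one_dvd _, hn0⟩) h

theorem truncFun_verschiebung_eq_zero {m N e : ℕ} [NeZero N] (h : m ∣ N) (hem : ¬N / e ∣ m)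
    (x : BigWitt e R) : truncFun m (verschiebung N x) = 0 := by
  ext ⟨k, hk⟩
  have hkm := Nat.dvd_of_mem_divisors hk
  change (verschiebung N x).get k = 0
  rw [get_of_dvd _ (hkm.trans h)]
  exact if_neg fun h' => hem (h'.trans hkm)

end Truncation

/-! ### Leading coordinates and additive generators of Witt vectors -/

section Leading

variable {A : Type u} [CommRing A] {N : ℕ} [NeZero N]

theorem ghost_sub {x y : BigWitt N A} {n : ℕ} (hn : n ∣ N) :
    (x - y).ghost n = x.ghost n - y.ghost n :=
  map_sub (ghostHom A N n hn) x y

/-- The ghost coordinates of `y` vanish below `n`, and the one at `n` is `n * a`. -/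
def HasLeading (y : BigWitt N A) (n : ℕ) (a : A) : Prop :=
  (∀ k, k ∣ N → k < n → y.ghost k = 0) ∧ y.ghost n = n * a

theorem HasLeading.zero {n : ℕ} (hn : n ∣ N) : HasLeading (0 : BigWitt N A) n 0 :=
  ⟨fun _ hk _ => ghost_zero hk, by rw [ghost_zero hn, mul_zero]⟩

/-- Witt coordinates are not additive in general; the leading one is, because it is read off from a
ghost coordinate. -/
theorem HasLeading.add {x y : BigWitt N A} {n : ℕ} {a b : A} (hn : n ∣ N)
    (hx : HasLeading x n a) (hy : HasLeading y n b) : HasLeading (x + y) n (a + b) :=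
  ⟨fun k hk hkn => by rw [ghost_add _ _ hk, hx.1 k hk hkn, hy.1 k hk hkn, add_zero], by
    rw [ghost_add _ _ hn, hx.2, hy.2, mul_add]⟩

theorem HasLeading.zsmul {x : BigWitt N A} {n : ℕ} {a : A} (hn : n ∣ N) (hx : HasLeading x n a)
    (c : ℤ) : HasLeading (c • x) n (c • a) := by
  have h : ∀ k, k ∣ N → (c • x).ghost k = c • x.ghost k := fun k hk =>
    map_zsmul (ghostHom A N k hk) c x
  exact ⟨fun k hk hkn => by rw [h k hk, hx.1 k hk hkn, smul_zero], by
    rw [h n hn, hx.2, mul_smul_comm]⟩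

theorem hasLeading_verschiebung_teichmuller {n : ℕ} (hn : n ∣ N) (a : A) :
    HasLeading (verschiebung N (teichmuller (N / n) a)) n a := by
  have hn0 : 0 < n := Nat.pos_of_dvd_of_pos hn (NeZero.pos N)
  have : NeZero (N / n) := ⟨(Nat.div_pos (Nat.le_of_dvd (NeZero.pos N) hn) hn0).ne'⟩
  have e : N / (N / n) = n := Nat.div_div_self hn (NeZero.ne N)
  refine ⟨fun k hk hkn => ghost_verschiebung_of_not_dvd _ hk fun h => ?_, ?_⟩
  · rw [e] at h
    exact absurd (Nat.le_of_dvd (Nat.pos_of_dvd_of_pos hk (NeZero.pos N)) h) (by omega)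
  · have h := ghost_verschiebung (m := N) (teichmuller (N / n) a) (n := 1) (by simpa [e])
    rwa [mul_one, e, ghost_teichmuller a (one_dvd _), pow_one] at h

/-- When the lower ghost coordinates vanish, so do the Witt coordinates at proper divisors of `n`,
and only the term `n * x_n` of the ghost sum survives. -/
theorem hasLeading_get [IsDomain A] [CharZero A] {x : BigWitt N A} {n : ℕ} (hn : n ∣ N)
    (h : ∀ k, k ∣ N → k < n → x.ghost k = 0) : HasLeading x n (x.get n) := by
  refine ⟨h, ?_⟩
  have hn0 : n ≠ 0 := ne_zero_of_dvd_ne_zero (NeZero.ne N) hn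
  rw [ghost, ghostSum_eq_add _ hn0, Finset.sum_eq_zero, zero_add]
  intro k hk
  obtain ⟨hkn, hlt⟩ := Nat.mem_properDivisors.1 hk
  have hk0 : k ≠ 0 := ne_zero_of_dvd_ne_zero hn0 hkn
  have h0 : x.get k = (0 : BigWitt N A).get k := by
    refine ghostSum_injective (m := k) (fun j hj => ?_) hk0 k dvd_rfl
    have hjN := (hj.trans hkn).trans hn
    exact (h j hjN ((Nat.le_of_dvd (Nat.pos_of_ne_zero hk0) hj).trans_lt hlt)).trans
      (ghost_zero hjN).symm
  have h1 : x.get k = 0 := by rw [h0, get_of_dvd _ (hkn.trans hn)]; rfl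
  rw [h1, zero_pow (Nat.div_pos (Nat.le_of_dvd (Nat.pos_of_ne_zero hn0) hkn)
    (Nat.pos_of_ne_zero hk0)).ne', mul_zero]

/-- A subgroup `K` of Witt vectors is contained in `H` once `K ⊓ H` realizes all leading
coordinates of elements of `K`. -/
theorem le_of_hasLeading [IsDomain A] [CharZero A] {K H : AddSubgroup (BigWitt N A)}
    (h : ∀ x ∈ K, ∀ n, n ∣ N → ∃ y ∈ K ⊓ H, HasLeading y n (x.get n)) : K ≤ H := by
  -- Induction on the room `j` left above `n`: subtracting `y` kills the ghost coordinate at `n`,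
  -- and the difference stays in `K` because `y` lies in `K`. Once `n` exceeds `N`, all ghost
  -- coordinates vanish and `x = 0`.
  have key : ∀ j n : ℕ, N + 1 ≤ n + j → ∀ x ∈ K, (∀ k, k ∣ N → k < n → x.ghost k = 0) →
      x ∈ H := by
    intro j
    induction j with
    | zero =>
      intro n hn x _ hx
      have : x = 0 := ext_ghost fun k hk => by
        rw [hx k hk (by have := Nat.le_of_dvd (NeZero.pos N) hk; omega), ghost_zero hk]
      exact this ▸ H.zero_mem
    | succ j ih =>
      intro n hn x hxK hx
      by_cases hnN : n ∣ N
      · obtain ⟨y, hy, hyl⟩ := h x hxK n hnN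
        have := ih (n + 1) (by omega) (x - y) (K.sub_mem hxK hy.1) fun k hk hkn => ?_
        · simpa using H.add_mem this hy.2
        · rw [ghost_sub hk]
          rcases Nat.lt_succ_iff_lt_or_eq.1 hkn with hlt | rfl
          · rw [hx k hk hlt, hyl.1 k hk hlt, sub_zero]
          · rw [(hasLeading_get hnN hx).2, hyl.2, sub_self]
      · refine ih (n + 1) (by omega) x hxK fun k hk hkn => hx k hk ?_
        rcases Nat.lt_succ_iff_lt_or_eq.1 hkn with hlt | rfl
        · exact hlt
        · exact absurd hk hnN
  exact fun x hx => key (N + 1) 0 (by omega) x hx fun _ _ h => absurd h (Nat.not_lt_zero _)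

/-- Over a polynomial ring, the Witt vectors are additively generated by the Verschiebungen of the
Teichmüller representatives of monomials. -/
theorem closure_verschiebung_monomial (σ : Type u) :
    AddSubgroup.closure {x : BigWitt N (MvPolynomial σ ℤ) | ∃ e, e ∣ N ∧ ∃ t : σ →₀ ℕ,
      x = verschiebung N (teichmuller e (MvPolynomial.monomial t 1))} = ⊤ := by
  refine top_le_iff.1 (le_of_hasLeading fun x _ n hn => ?_)
  rw [top_inf_eq]
  -- The Teichmüller map is not additive, but leading coordinates are, so every polynomial is
  -- reached as a leading coordinate from monomials with coefficient one.
  induction x.get n using MvPolynomial.induction_on' with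
  | monomial t c =>
    refine ⟨c • verschiebung N (teichmuller (N / n) (MvPolynomial.monomial t 1)), ?_, ?_⟩
    · refine AddSubgroup.zsmul_mem _ (AddSubgroup.subset_closure ?_) _
      exact ⟨N / n, Nat.div_dvd_of_dvd hn, t, rfl⟩
    have := (hasLeading_verschiebung_teichmuller hn
      (MvPolynomial.monomial t (1 : ℤ))).zsmul hn c
    rwa [MvPolynomial.smul_monomial, smul_eq_mul, mul_one] at this
  | add p q hp hq =>
    obtain ⟨y, hy, hyl⟩ := hp
    obtain ⟨z, hz, hzl⟩ := hq
    exact ⟨y + z, AddSubgroup.add_mem _ hy hz, hyl.add hn hzl⟩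

end Leading

end BigWitt

open BigWitt

/-! ### Construction of the cyclotomic Frobenius -/

section Existence

/-- Used contrapositively: if the place `n = dm/e` does not divide `m`, then `d` does not divide
`e`, and `V_{dm/e}` is killed. -/
theorem mul_div_dvd_of_dvd {d m e : ℕ} (hd : 0 < d) (he : e ∣ d * m) (h : d ∣ e) :
    d * m / e ∣ m := by
  obtain ⟨a, rfl⟩ := h
  rw [Nat.mul_div_mul_left _ _ hd]
  exact Nat.div_dvd_of_dvd (Nat.dvd_of_mul_dvd_mul_left hd he)

theorem C_verschiebung_mem {R : Type u} [CommRing R] {d e N : ℕ} (he : e ∣ N) (hde : ¬d ∣ e)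
    (x : BigWitt e R) : C (verschiebung N x) ∈ qWittAtIdeal d N R := by
  refine Ideal.subset_span (Or.inl ⟨e, he, x, ?_⟩)
  -- A divisor `k` of `e` with `d ∣ k` would give `d ∣ e`; hence the cyclotomic product is empty.
  rw [Finset.filter_eq_empty_iff.2, Finset.prod_empty, one_mul]
  exact fun k hk hdk => hde (hdk.trans (Nat.dvd_of_mem_divisors hk))

variable {R : Type u} [CommRing R] {d m : ℕ} [NeZero d] [NeZero m]

/-- Over a polynomial ring the leading coordinate of a kernel element is nonzero only at places `n`
not dividing `m`, where `V_n[a]` lies both in the kernel and in the ideal. The general case follows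
by lifting along `cover R`. -/
theorem C_mem_of_truncFun_eq_zero {x : BigWitt (d * m) R} (hx : truncFun m x = 0) :
    C x ∈ qWittAtIdeal d (d * m) R := by
  have hN : d * m ≠ 0 := NeZero.ne _
  have hle : (trunc (MvPolynomial R ℤ) (dvd_mul_left m d)).toAddMonoidHom.ker ≤
      (qWittAtIdeal d (d * m) (MvPolynomial R ℤ)).toAddSubgroup.comap
        (C : _ →+* (BigWitt (d * m) (MvPolynomial R ℤ))[X]).toAddMonoidHom := by
    refine le_of_hasLeading fun y hy n hn => ?_
    have hy' : truncFun m y = 0 := hy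
    by_cases hnm : n ∣ m
    · refine ⟨0, AddSubgroup.zero_mem _, ?_⟩
      rw [← get_truncFun y hnm, hy', get_of_dvd _ hnm]
      exact HasLeading.zero hn
    · have he : d * m / (d * m / n) = n := Nat.div_div_self hn hN
      refine ⟨_, ⟨?_, ?_⟩, hasLeading_verschiebung_teichmuller hn _⟩
      · exact truncFun_verschiebung_eq_zero (dvd_mul_left m d) (by rwa [he]) _
      · refine C_verschiebung_mem (Nat.div_dvd_of_dvd hn) (fun h => hnm ?_) _
        have := mul_div_dvd_of_dvd (NeZero.pos d) (Nat.div_dvd_of_dvd hn) h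
        rwa [he] at this
  obtain ⟨y, hy, rfl⟩ : ∃ y : BigWitt (d * m) (MvPolynomial R ℤ),
      truncFun m y = 0 ∧ mapFun (cover R) y = x := by
    classical
    -- The lift must itself have zero truncation, so the coordinates at divisors of `m` are lifted
    -- by zero instead of by an arbitrary preimage.
    refine ⟨⟨fun k => if (k : ℕ) ∣ m then 0 else (cover_surjective R (x.coeff k)).choose⟩, ?_, ?_⟩
    · refine BigWitt.ext (funext fun ⟨k, hk⟩ => ?_)
      have hkm := Nat.dvd_of_mem_divisors hk
      change BigWitt.get _ k = 0
      rw [get_of_dvd _ (hkm.mul_left d)]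
      exact if_pos hkm
    · ext ⟨k, hk⟩
      change cover R (if k ∣ m then 0 else _) = _
      split_ifs with hkm
      · have := congrArg (fun z => z.get k) hx
        simp only [get_truncFun x hkm] at this
        rw [get_of_dvd _ (hkm.mul_left d), get_of_dvd _ hkm] at this
        rw [map_zero]
        exact this.symm
      · exact (cover_surjective R (x.coeff ⟨k, hk⟩)).choose_spec
  have h := qWittAtIdeal_le_comap d (d * m) (cover R) (hle hy)
  rw [Ideal.mem_comap] at h
  simpa [BigWitt.map] using h

variable (R d m)

/-- The ring map `W_m(R) → q-W_{dm}^{(d)}(R)` induced by `W_{dm}(R) → q-W_{dm}^{(d)}(R)`. -/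
noncomputable def wittToQWittAt : BigWitt m R →+* QWittAt d (d * m) R :=
  (trunc R (dvd_mul_left m d)).liftOfSurjective (truncFun_surjective (dvd_mul_left m d))
    ⟨(Ideal.Quotient.mk _).comp C, fun _ hx =>
      Ideal.Quotient.eq_zero_iff_mem.2 (C_mem_of_truncFun_eq_zero hx)⟩

variable {R}

theorem wittToQWittAt_truncFun (x : BigWitt (d * m) R) :
    wittToQWittAt R d m (truncFun m x) = Ideal.Quotient.mk _ (C x) :=
  (trunc R (dvd_mul_left m d)).liftOfRightInverse_comp_apply _ _ ⟨_, _⟩ x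

variable (R)

/-- The map `W_m(R)[q] → q-W_{dm}^{(d)}(R)` with `q ↦ q ^ d`. -/
noncomputable def preCycFrob : (BigWitt m R)[X] →+* QWittAt d (d * m) R :=
  eval₂RingHom (wittToQWittAt R d m) (Ideal.Quotient.mk _ (X ^ d))

theorem preCycFrob_C (x : BigWitt m R) : preCycFrob R d m (C x) = wittToQWittAt R d m x := by
  simp [preCycFrob]

theorem preCycFrob_X : preCycFrob R d m X = Ideal.Quotient.mk _ (X ^ d) := by
  simp [preCycFrob]

theorem preCycFrob_verschiebung {e : ℕ} (he : e ∣ m) (x : BigWitt (d * e) R) :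
    preCycFrob R d m (C (verschiebung m (truncFun e x)))
      = Ideal.Quotient.mk _ (C (verschiebung (d * m) x)) := by
  rw [preCycFrob_C, ← truncFun_verschiebung he, wittToQWittAt_truncFun]

theorem preCycFrob_eq_zero (a : (BigWitt m R)[X]) (ha : a ∈ qWittIdeal m R) :
    preCycFrob R d m a = 0 := by
  rw [← RingHom.mem_ker]
  revert a
  change qWittIdeal m R ≤ RingHom.ker (preCycFrob R d m)
  rw [qWittIdeal, Ideal.span_le]
  rintro a (⟨e, he, x, rfl⟩ | ⟨e, f, hef, hf, x, rfl⟩)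
  · have : NeZero e := ⟨ne_zero_of_dvd_ne_zero (NeZero.ne m) he⟩
    obtain ⟨x, rfl⟩ := truncFun_surjective (dvd_mul_left e d) x
    -- `q^{de} - 1` is the product of all `Φ_k` with `k ∣ de`; the factors with `d ∣ k` alone
    -- already annihilate the Verschiebung.
    rw [SetLike.mem_coe, RingHom.mem_ker, map_mul, preCycFrob_verschiebung R d m he, map_sub,
      map_pow, map_one, preCycFrob_X, ← map_pow, ← pow_mul, ← map_one (Ideal.Quotient.mk _),
      ← map_sub, ← map_mul, Ideal.Quotient.eq_zero_iff_mem,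
      ← prod_cyclotomic_eq_X_pow_sub_one (NeZero.pos (d * e)),
      ← Finset.prod_filter_mul_prod_filter_not _ (fun k => d ∣ k), mul_right_comm]
    exact Ideal.mul_mem_right _ _
      (Ideal.subset_span (Or.inl ⟨d * e, mul_dvd_mul_left d he, x, rfl⟩))
  · have : NeZero f := ⟨ne_zero_of_dvd_ne_zero (NeZero.ne m) hf⟩
    have : NeZero e := ⟨ne_zero_of_dvd_ne_zero (NeZero.ne f) hef⟩
    obtain ⟨x, rfl⟩ := truncFun_surjective (dvd_mul_left f d) x
    -- Since `(q^d)^e = q^{de}` and `df/(de) = f/e`, the relation at `e ∣ f` becomes the one at `de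
    -- ∣ df`.
    rw [SetLike.mem_coe, RingHom.mem_ker, ← truncFun_frobenius hef, map_sub, map_mul,
      preCycFrob_verschiebung R d m hf, preCycFrob_verschiebung R d m (hef.trans hf), map_qInt,
      map_pow, preCycFrob_X, ← map_pow, ← pow_mul, ← map_qInt, ← map_mul, ← map_sub,
      Ideal.Quotient.eq_zero_iff_mem, ← Nat.mul_div_mul_left f e (NeZero.pos d)]
    exact Ideal.subset_span (Or.inr ⟨d * e, d * f, dvd_mul_right d e, mul_dvd_mul_left d hef,
      mul_dvd_mul_left d hf, x, rfl⟩)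

/-- The cyclotomic Frobenius `q-W_m(R) → q-W_{dm}^{(d)}(R)`. -/
noncomputable def cycFrob : QWitt m R →+* QWittAt d (d * m) R :=
  Ideal.Quotient.lift _ (preCycFrob R d m) (preCycFrob_eq_zero R d m)

theorem qWittAtMap_comp_cycFrob {R S : Type u} [CommRing R] [CommRing S] (f : R →+* S) :
    (QWittAt.map d (d * m) f).comp (cycFrob R d m) = (cycFrob S d m).comp (QWitt.map m f) := by
  refine Ideal.Quotient.ringHom_ext (Polynomial.ringHom_ext (fun x => ?_) ?_)
  · obtain ⟨x, rfl⟩ := truncFun_surjective (dvd_mul_left m d) x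
    have h : BigWitt.map m f (truncFun m x) = truncFun m (BigWitt.map (d * m) f x) :=
      mapFun_truncFun f x
    simp only [cycFrob, QWittAt.map, QWitt.map, RingHom.comp_apply, Ideal.Quotient.lift_mk,
      Ideal.quotientMap_mk, coe_mapRingHom, map_C, preCycFrob_C, wittToQWittAt_truncFun, h]
  · simp only [cycFrob, QWittAt.map, QWitt.map, RingHom.comp_apply, Ideal.Quotient.lift_mk,
      Ideal.quotientMap_mk, coe_mapRingHom, map_X, preCycFrob_X, Polynomial.map_pow]

/-- At the index `de` both sides use `gh_{dm/(de)} = gh_{m/e}`, and truncation leaves the ghost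
coordinates at divisors of `m` unchanged. -/
theorem qGhostAt_comp_cycFrob :
    (qGhostAt R d (d * m)).comp (cycFrob R d m) = (ghostFrob R d m).comp (qGhost R m) := by
  refine Ideal.Quotient.ringHom_ext (Polynomial.ringHom_ext (fun x => ?_) ?_)
  · obtain ⟨x, rfl⟩ := truncFun_surjective (dvd_mul_left m d) x
    funext ⟨e, hde, he⟩
    obtain ⟨e, rfl⟩ := hde
    have he' : e ∣ m := Nat.dvd_of_mul_dvd_mul_left (NeZero.pos d) he
    simp only [cycFrob, qGhostAt, qGhost, ghostFrob, cycSubst, RingHom.comp_apply,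
      Ideal.Quotient.lift_mk, RingHom.pi_apply, preCycFrob_C, wittToQWittAt_truncFun,
      Pi.evalRingHom_apply, preQGhost_C, Ideal.quotientMap_mk]
    rw [ghost_truncFun _ (Nat.div_dvd_of_dvd (by rwa [Nat.mul_div_cancel_left _ (NeZero.pos d)])),
      Nat.mul_div_mul_left _ _ (NeZero.pos d), Nat.mul_div_cancel_left _ (NeZero.pos d)]
    simp
  · funext e
    simp [cycFrob, qGhostAt, qGhost, ghostFrob, cycSubst, preCycFrob_X, preQGhost]

end Existence

theorem qGhostAt_mk (R : Type u) [CommRing R] (d N : ℕ) [NeZero N] (a : (BigWitt N R)[X])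
    (k : {k : ℕ // d ∣ k ∧ k ∣ N}) :
    qGhostAt R d N (Ideal.Quotient.mk _ a) k = preQGhost R N k k.2.2 a := rfl

/-! ### Injectivity of the `q`-ghost map over polynomial rings -/

section Injectivity

/-- The greatest divisor `g` of `m` such that the monomial with exponent `s` is a `g`-th power. -/
def monoGcd (m : ℕ) {σ : Type u} (s : σ →₀ ℕ) : ℕ := m.gcd (s.support.gcd s)

/-- The exponent of the `e`-th root of a monomial. -/
noncomputable def monoRoot (e : ℕ) {σ : Type u} (s : σ →₀ ℕ) : σ →₀ ℕ :=
  s.mapRange (· / e) (Nat.zero_div e)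

theorem dvd_monoGcd_iff {m e : ℕ} {σ : Type u} {s : σ →₀ ℕ} :
    e ∣ monoGcd m s ↔ e ∣ m ∧ ∀ i, e ∣ s i := by
  rw [monoGcd, Nat.dvd_gcd_iff, Finset.dvd_gcd_iff]
  refine and_congr_right fun _ => ⟨fun h i => ?_, fun h i _ => h i⟩
  by_cases hi : i ∈ s.support
  · exact h i hi
  · simp [Finsupp.notMem_support_iff.1 hi]

theorem smul_monoRoot {m e : ℕ} {σ : Type u} {s : σ →₀ ℕ} (h : e ∣ monoGcd m s) :
    e • monoRoot e s = s := by
  ext i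
  simp [monoRoot, Nat.mul_div_cancel' ((dvd_monoGcd_iff.1 h).2 i)]

theorem monoRoot_smul {e : ℕ} (he : 0 < e) {σ : Type u} (t : σ →₀ ℕ) :
    monoRoot e (e • t) = t := by
  ext i
  simp [monoRoot, Nat.mul_div_cancel_left _ he]

/-- With `g = monoGcd m s`, the `g/e`-th power of the `g`-th root is the `e`-th root. This computes
both Frobenius and ghost coordinates on the generators. -/
theorem smul_monoRoot_monoGcd {m e : ℕ} (he : 0 < e) {σ : Type u} {s : σ →₀ ℕ}
    (h : e ∣ monoGcd m s) :
    (monoGcd m s / e) • monoRoot (monoGcd m s) s = monoRoot e s := by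
  conv_rhs => rw [← smul_monoRoot (dvd_refl (monoGcd m s)), ← Nat.mul_div_cancel' h, mul_smul]
  rw [monoRoot_smul he, Nat.mul_div_cancel' h]

variable (σ : Type u) (d m : ℕ)

/-- The structure map `ℤ[q] → q-W_{dm}^{(d)}(ℤ[T])`. -/
noncomputable def qScalar : ℤ[X] →+* QWittAt d (d * m) (MvPolynomial σ ℤ) :=
  (Ideal.Quotient.mk _).comp (mapRingHom (Int.castRingHom _))

variable {σ}

/-- The generator of `q-W_{dm}^{(d)}(ℤ[T])` over `ℤ[q]` attached to a monomial: the Verschiebung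
of the Teichmüller representative of its maximal root. -/
noncomputable def qGen (s : σ →₀ ℕ) : QWittAt d (d * m) (MvPolynomial σ ℤ) :=
  Ideal.Quotient.mk _ (C (verschiebung (d * m)
    (teichmuller (d * monoGcd m s) (MvPolynomial.monomial (monoRoot (monoGcd m s) s) 1))))

variable (σ)

/-- The `ℤ[q]`-linear combinations of the generators. -/
noncomputable def qComb : ((σ →₀ ℕ) →₀ ℤ[X]) →+ QWittAt d (d * m) (MvPolynomial σ ℤ) :=
  Finsupp.liftAddHom fun s =>
    (AddMonoidHom.mulRight (qGen d m s)).comp (qScalar σ d m).toAddMonoidHom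

variable {σ}

theorem qComb_single (s : σ →₀ ℕ) (p : ℤ[X]) :
    qComb σ d m (Finsupp.single s p) = qScalar σ d m p * qGen d m s := by
  simp [qComb]

theorem qComb_apply (c : (σ →₀ ℕ) →₀ ℤ[X]) :
    qComb σ d m c = ∑ s ∈ c.support, qScalar σ d m (c s) * qGen d m s := by
  simp [qComb, Finsupp.sum]

theorem qScalar_mul_mem_range (p : ℤ[X]) {b : QWittAt d (d * m) (MvPolynomial σ ℤ)}
    (hb : b ∈ (qComb σ d m).range) : qScalar σ d m p * b ∈ (qComb σ d m).range := by
  obtain ⟨c, rfl⟩ := hb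
  rw [qComb_apply, Finset.mul_sum]
  refine AddSubgroup.sum_mem _ fun s _ => ⟨Finsupp.single s (p * c s), ?_⟩
  rw [qComb_single, map_mul, mul_assoc]

theorem qScalar_mul_qGen_eq_zero (s : σ →₀ ℕ) :
    qScalar σ d m (∏ k ∈ (d * monoGcd m s).divisors with d ∣ k, cyclotomic k ℤ) * qGen d m s
      = 0 := by
  rw [qScalar, qGen, RingHom.comp_apply, ← map_mul, Ideal.Quotient.eq_zero_iff_mem,
    coe_mapRingHom, Polynomial.map_prod]
  simp only [map_cyclotomic]
  exact Ideal.subset_span (Or.inl ⟨d * monoGcd m s,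
    mul_dvd_mul_left d (dvd_monoGcd_iff.1 dvd_rfl).1, _, rfl⟩)

variable [NeZero d] [NeZero m]

theorem monoGcd_pos (s : σ →₀ ℕ) : 0 < monoGcd m s := Nat.gcd_pos_of_pos_left _ (NeZero.pos m)

theorem frobenius_teichmuller {e f : ℕ} [NeZero f] [NeZero e] (hef : e ∣ f) {A : Type u}
    [CommRing A] [IsDomain A] [CharZero A] (a : A) :
    frobenius e (teichmuller f a) = teichmuller e (a ^ (f / e)) := by
  refine ext_ghost fun n hn => ?_
  rw [ghost_frobenius hef _ hn, ghost_teichmuller _ hn, ghost_teichmuller, pow_mul]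
  calc f / e * n ∣ f / e * e := mul_dvd_mul_left _ hn
    _ = f := Nat.div_mul_cancel hef

/-- The relation between levels `de` and `dg` trades `V ∘ F` for a `q`-integer multiple of `V`. As
`F_{g/e}` raises Teichmüller representatives to the power `g/e`, every monomial can be replaced by
its maximal root. -/
theorem mk_verschiebung_monomial_mem_range {e : ℕ} (he : e ∣ d * m) (t : σ →₀ ℕ) :
    Ideal.Quotient.mk (qWittAtIdeal d (d * m) (MvPolynomial σ ℤ))
      (C (verschiebung (d * m) (teichmuller e (MvPolynomial.monomial t 1))))
        ∈ (qComb σ d m).range := by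
  by_cases hde : d ∣ e
  · obtain ⟨e, rfl⟩ := hde
    have hem : e ∣ m := Nat.dvd_of_mul_dvd_mul_left (NeZero.pos d) he
    have he0 : 0 < e := Nat.pos_of_dvd_of_pos hem (NeZero.pos m)
    have hg : e ∣ monoGcd m (e • t) := dvd_monoGcd_iff.2 ⟨hem, fun i => by simp⟩
    have : NeZero e := ⟨he0.ne'⟩
    have : NeZero (monoGcd m (e • t)) := ⟨(monoGcd_pos m _).ne'⟩
    -- The index is `e • t` because `T^t` enters at level `de` as the `e`-th root of that monomial.
    refine ⟨Finsupp.single (e • t) (qInt (monoGcd m (e • t) / e) (X ^ (d * e))), ?_⟩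
    rw [qComb_single, qScalar, qGen, RingHom.comp_apply, ← map_mul, Ideal.Quotient.eq, map_qInt,
      map_pow, coe_mapRingHom, map_X, ← Nat.mul_div_mul_left _ e (NeZero.pos d)]
    refine Ideal.subset_span (Or.inr ⟨d * e, d * monoGcd m (e • t), dvd_mul_right d e,
      mul_dvd_mul_left d hg, mul_dvd_mul_left d (dvd_monoGcd_iff.1 dvd_rfl).1,
      teichmuller _ (MvPolynomial.monomial (monoRoot (monoGcd m (e • t)) (e • t)) 1), ?_⟩)
    rw [frobenius_teichmuller (mul_dvd_mul_left d hg), MvPolynomial.monomial_pow, one_pow,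
      Nat.mul_div_mul_left _ e (NeZero.pos d), smul_monoRoot_monoGcd he0 hg, monoRoot_smul he0]
  · rw [Ideal.Quotient.eq_zero_iff_mem.2 (C_verschiebung_mem he hde _)]
    exact AddSubgroup.zero_mem _

theorem qComb_surjective : Function.Surjective (qComb σ d m) := by
  rw [← AddMonoidHom.range_eq_top, AddSubgroup.eq_top_iff']
  intro b
  obtain ⟨a, rfl⟩ := Ideal.Quotient.mk_surjective b
  have hC : ∀ x : BigWitt (d * m) (MvPolynomial σ ℤ),
      Ideal.Quotient.mk (qWittAtIdeal d (d * m) (MvPolynomial σ ℤ)) (C x)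
        ∈ (qComb σ d m).range := by
    intro x
    have hx : x ∈ (⊤ : AddSubgroup (BigWitt (d * m) (MvPolynomial σ ℤ))) := trivial
    rw [← closure_verschiebung_monomial] at hx
    induction hx using AddSubgroup.closure_induction with
    | mem x hx =>
      obtain ⟨e, he, t, rfl⟩ := hx
      exact mk_verschiebung_monomial_mem_range d m he t
    | zero => simp
    | add x y _ _ hx hy =>
      rw [map_add, map_add]
      exact AddSubgroup.add_mem _ hx hy
    | neg x _ hx =>
      rw [map_neg, map_neg]
      exact AddSubgroup.neg_mem _ hx
  induction a using Polynomial.induction_on' with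
  | add p q hp hq =>
    rw [map_add]
    exact AddSubgroup.add_mem _ hp hq
  | monomial n x =>
    have h := qScalar_mul_mem_range d m (X ^ n) (hC x)
    rwa [qScalar, RingHom.comp_apply, ← map_mul, coe_mapRingHom, Polynomial.map_pow, map_X,
      mul_comm (X ^ n), C_mul_X_pow_eq_monomial] at h

/-- Exchange of the polynomial variable with the coefficients. -/
noncomputable def polySwap (σ : Type u) : (MvPolynomial σ ℤ)[X] →+* MvPolynomial σ ℤ[X] :=
  eval₂RingHom (MvPolynomial.map C) (MvPolynomial.C X)

theorem polySwap_map (p : ℤ[X]) :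
    polySwap σ (p.map (Int.castRingHom _)) = MvPolynomial.C p := by
  have : ((polySwap σ).comp (mapRingHom (Int.castRingHom _))) = MvPolynomial.C :=
    Polynomial.ringHom_ext (fun a => by simp) (by simp [polySwap])
  exact congrArg (fun f => f p) this

theorem polySwap_C_monomial (r : σ →₀ ℕ) (n : ℤ) :
    polySwap σ (C (MvPolynomial.monomial r n)) = MvPolynomial.monomial r (C n) := by
  simp [polySwap]

/-- The Verschiebung contributes the factor `m/g`, with `g = monoGcd m s`, and `gh_{g/e}` raises the
`g`-th root to the power `g/e`. If `e` does not divide `g`, the Verschiebung has no ghost component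
there. -/
theorem qGhostAt_qGen (s : σ →₀ ℕ) {e : ℕ} (he : e ∣ m) :
    qGhostAt _ d (d * m) (qGen d m s) ⟨d * e, dvd_mul_right d e, mul_dvd_mul_left d he⟩
      = Ideal.Quotient.mk _ (if e ∣ monoGcd m s then
          C (MvPolynomial.monomial (monoRoot e s) ((m / monoGcd m s : ℕ) : ℤ)) else 0) := by
  have hg : monoGcd m s ∣ m := (dvd_monoGcd_iff.1 dvd_rfl).1
  have : NeZero (monoGcd m s) := ⟨(monoGcd_pos m s).ne'⟩
  rw [qGen, qGhostAt_mk]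
  split_ifs with h
  · have he0 : 0 < e := Nat.pos_of_dvd_of_pos he (NeZero.pos m)
    rw [preQGhost_verschiebung _ _ _ (mul_dvd_mul_left d hg) _ (mul_dvd_mul_left d h),
      ghost_teichmuller _ (Nat.div_dvd_of_dvd (mul_dvd_mul_left d h)),
      Nat.mul_div_mul_left _ _ (NeZero.pos d), Nat.mul_div_mul_left _ _ (NeZero.pos d),
      MvPolynomial.monomial_pow, one_pow, smul_monoRoot_monoGcd he0 h,
      ← map_natCast (Ideal.Quotient.mk _), ← map_mul, ← map_natCast C, ← C_mul,
      ← map_natCast MvPolynomial.C, MvPolynomial.C_mul_monomial, mul_one]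
  · rw [preQGhost_verschiebung_of_not_dvd _ _ _ (mul_dvd_mul_left d hg) _ fun h' => h
      (Nat.dvd_of_mul_dvd_mul_left (NeZero.pos d) h'), map_zero]

theorem qGhostAt_qScalar (p : ℤ[X]) (k : {k : ℕ // d ∣ k ∧ k ∣ d * m}) :
    qGhostAt _ d (d * m) (qScalar σ d m p) k
      = Ideal.Quotient.mk _ (p.map (Int.castRingHom _)) := by
  rw [qScalar, RingHom.comp_apply, qGhostAt_mk, preQGhost, RingHom.comp_apply, coe_mapRingHom,
    coe_mapRingHom, Polynomial.map_map]
  congr 2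
  exact RingHom.ext_int _ _

/-- At the index `de`, distinct generators with nonzero ghost coordinate have distinct monomials,
since a monomial is recovered from its `e`-th root. Hence the coefficient of `T^{s/e}` isolates `c
s` up to a nonzero integer. -/
theorem cyclotomic_dvd_coeff {c : (σ →₀ ℕ) →₀ ℤ[X]}
    (hc : qGhostAt _ d (d * m) (qComb σ d m c) = 0) (s : σ →₀ ℕ) {e : ℕ}
    (he : e ∣ monoGcd m s) : cyclotomic (d * e) ℤ ∣ c s := by
  classical
  have hg : monoGcd m s ∣ m := (dvd_monoGcd_iff.1 dvd_rfl).1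
  have hem : e ∣ m := he.trans hg
  have he0 : 0 < e := Nat.pos_of_dvd_of_pos hem (NeZero.pos m)
  have h := congrFun hc ⟨d * e, dvd_mul_right d e, mul_dvd_mul_left d hem⟩
  rw [qComb_apply, map_sum, Finset.sum_apply] at h
  simp only [map_mul, Pi.mul_apply, qGhostAt_qGen d m _ hem, qGhostAt_qScalar] at h
  simp only [← map_mul] at h
  rw [← map_sum, Pi.zero_apply, Ideal.Quotient.eq_zero_iff_mem, Ideal.mem_span_singleton,
    ← map_cyclotomic_int] at h
  -- With `T` as the variables over `ℤ[q]`, divisibility by `Φ_{de}(q)` can be tested on each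
  -- coefficient separately.
  have h2 := map_dvd (polySwap σ) h
  rw [polySwap_map, MvPolynomial.C_dvd_iff_dvd_coeff] at h2
  have h3 := h2 (monoRoot e s)
  rw [map_sum, MvPolynomial.coeff_sum, Finset.sum_eq_single s] at h3
  · rw [if_pos he, map_mul, polySwap_map, polySwap_C_monomial, MvPolynomial.coeff_C_mul,
      MvPolynomial.coeff_monomial, if_pos rfl] at h3
    have hpos : 0 < d * e := Nat.mul_pos (NeZero.pos d) he0
    refine ((cyclotomic.irreducible hpos).prime.dvd_or_dvd h3).resolve_right fun h4 => ?_
    -- `Φ_{de}` has degree `φ(de) > 0`, so it cannot divide a nonzero constant.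
    have hne : ((m / monoGcd m s : ℕ) : ℤ) ≠ 0 :=
      Int.natCast_ne_zero.2 (Nat.div_pos (Nat.le_of_dvd (NeZero.pos m) hg) (monoGcd_pos m s)).ne'
    have h5 := natDegree_le_of_dvd h4 (C_ne_zero.2 hne)
    rw [natDegree_C, natDegree_cyclotomic] at h5
    exact absurd (Nat.totient_pos.2 hpos) (by omega)
  · intro t _ hts
    rw [map_mul, polySwap_map, MvPolynomial.coeff_C_mul]
    split_ifs with het
    · rw [polySwap_C_monomial, MvPolynomial.coeff_monomial, if_neg, mul_zero]
      intro heq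
      exact hts (by rw [← smul_monoRoot het, heq, smul_monoRoot he])
    · rw [map_zero, MvPolynomial.coeff_zero, mul_zero]
  · intro hs
    rw [Finsupp.notMem_support_iff.1 hs, Polynomial.map_zero, zero_mul, map_zero,
      MvPolynomial.coeff_zero]

/-- Distinct cyclotomic polynomials need not be comaximal in `ℤ[q]`, but they are non-associated
irreducibles, which is enough in a factorial ring. -/
theorem prod_cyclotomic_dvd {s : Finset ℕ} (hs : ∀ k ∈ s, 0 < k) {p : ℤ[X]}
    (h : ∀ k ∈ s, cyclotomic k ℤ ∣ p) : ∏ k ∈ s, cyclotomic k ℤ ∣ p := by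
  refine Finset.prod_dvd_of_isRelPrime (fun i hi j hj hij => ?_) h
  refine ((cyclotomic.irreducible (hs i hi)).isRelPrime_iff_not_dvd).2 fun hd => hij ?_
  have ha := (cyclotomic.irreducible (hs i hi)).associated_of_dvd
    (cyclotomic.irreducible (hs j hj)) hd
  exact cyclotomic_injective (R := ℤ)
    (eq_of_monic_of_associated (cyclotomic.monic i ℤ) (cyclotomic.monic j ℤ) ha)

/-- Over a polynomial ring, the `q`-ghost map of `q-W_{dm}^{(d)}` is injective. -/
theorem qGhostAt_injective : Function.Injective (qGhostAt (MvPolynomial σ ℤ) d (d * m)) := by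
  rw [injective_iff_map_eq_zero]
  intro b hb
  obtain ⟨c, rfl⟩ := qComb_surjective d m b
  rw [qComb_apply]
  -- Each summand vanishes on its own: its coefficient is a multiple of the annihilator of the
  -- generator.
  refine Finset.sum_eq_zero fun s _ => ?_
  obtain ⟨r, hr⟩ : ∏ k ∈ (d * monoGcd m s).divisors with d ∣ k, cyclotomic k ℤ ∣ c s := by
    refine prod_cyclotomic_dvd (fun k hk => Nat.pos_of_mem_divisors (Finset.mem_filter.1 hk).1)
      fun k hk => ?_
    obtain ⟨hk, e, rfl⟩ := Finset.mem_filter.1 hk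
    exact cyclotomic_dvd_coeff d m hb s
      (Nat.dvd_of_mul_dvd_mul_left (NeZero.pos d) (Nat.dvd_of_mem_divisors hk))
  rw [hr, map_mul, mul_right_comm, qScalar_mul_qGen_eq_zero, zero_mul]

end Injectivity

/-! ### Reduction of uniqueness to polynomial rings -/

theorem QWitt.map_surjective (m : ℕ) {R S : Type u} [CommRing R] [CommRing S] {f : R →+* S}
    (hf : Function.Surjective f) : Function.Surjective (QWitt.map m f) :=
  Ideal.quotientMap_surjective (Polynomial.map_surjective _ (mapFun_surjective hf))

theorem mainTheorem8 (d m : ℕ) [NeZero d] [NeZero m] :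
    ∃! Frob : (R : Type u) → [CommRing R] → (QWitt m R →+* QWittAt d (d * m) R),
      (∀ (R S : Type u) [CommRing R] [CommRing S] (f : R →+* S),
        (QWittAt.map d (d * m) f).comp (Frob R) = (Frob S).comp (QWitt.map m f)) ∧
      (∀ (R : Type u) [CommRing R],
        (qGhostAt R d (d * m)).comp (Frob R) = (ghostFrob R d m).comp (qGhost R m)) := by
  refine ⟨fun R _ => cycFrob R d m, ⟨fun R S _ _ f => qWittAtMap_comp_cycFrob d m f,
    fun R _ => qGhostAt_comp_cycFrob R d m⟩, fun Frob ⟨hnat, hghost⟩ => ?_⟩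
  funext R _
  -- The variables are indexed by `R` itself, which keeps the covering ring in the universe where
  -- the family is defined.
  have hA : Frob (MvPolynomial R ℤ) = cycFrob (MvPolynomial R ℤ) d m := by
    refine RingHom.ext fun x => qGhostAt_injective d m ?_
    exact RingHom.congr_fun ((hghost _).trans (qGhostAt_comp_cycFrob _ d m).symm) x
  -- Naturality along `cover R` determines the map on the image of a surjection.
  rw [← RingHom.cancel_right (QWitt.map_surjective m (cover_surjective R)), ← hnat,
    ← qWittAtMap_comp_cycFrob, hA]
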